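/- **Part 1.** Let $\mathbf{F}$ be a finite field of characteristic $p \ge 3$ and let $G \subseteq \mathrm{GL}_2(\mathbf{F})$ be a subgroup such that it is not the case that exactly one line (one-dimensional subspace) of $\mathbf{F}^2$ is mapped to itself by $G$. Then $H^1(G, \mathbf{F}^2) = 0$. **Part 2.** Let $A$ be an absolutely simple abelian variety over $\mathbf{Q}$ of $\mathrm{GL}_2$-type, with endomorphism ring $\mathcal{O} = \mathrm{End}_{\mathbf{Q}}(A)$, and let $\mathfrak{p}$ be a regular prime ideal of $\mathcal{O}$ whose residue field $\mathbf{F}_\mathfrak{p} = \mathcal{O}/\mathfrak{p}$ has characteristic $p(\mathfrak{p}) \ge 3$. Let $\rho_\mathfrak{p}$ denote the $\mathbf{F}_\mathfrak{p}$-linear representation of $\mathrm{Gal}(\overline{\mathbf{Q}}|\mathbf{Q})$ on $A[\mathfrak{p}](\overline{\mathbf{Q}})$. Let $F \subseteq \overline{\mathbf{Q}}$ be a number field that is a Galois extension of $\mathbf{Q}$, let $G_F = \mathrm{Gal}(\overline{\mathbf{Q}}|F)$, and let $F(A[\mathfrak{p}])$ be the smallest extension of $F$ in $\overline{\mathbf{Q}}$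 over which all points of $A[\mathfrak{p}](\overline{\mathbf{Q}})$ are defined. If the restriction $\rho_\mathfrak{p}|_{G_F}$ is irreducible (over $\mathbf{F}_\mathfrak{p}$), then $$H^1(F(A[\mathfrak{p}])|F,\, A[\mathfrak{p}]) = H^1\bigl(\mathrm{Gal}(F(A[\mathfrak{p}])|F),\, A[\mathfrak{p}]\bigr) = 0.$$ Here $A$ is *absolutely simple* if $\dim A > 0$ and $A_{\overline{\mathbf{Q}}}$ is not isogenous to a product of two abelian varieties of positive dimension. For an ideal $I$ of $\mathcal{O}$, $A[I]$ is the common kernel of all elements of $I$. A prime ideal of $\mathcal{O}$ is *regular* if its local ring is a discrete valuation ring. And $A$ is of *$\mathrm{GL}_2$-type* if $\mathcal{O}$ is an order in a number field and, for every regular prime ideal $\mathfrak{q}$ of $\mathcal{O}$ and every $n \ge 1$, $A[\mathfrak{q}^n](\overline{\mathbf{Q}})$ is free of rank $2$ over $\mathcal{O}/\mathfrak{q}^n$. -/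

import Mathlib

open CategoryTheory MonoidalCategory CartesianMonoidalCategory AlgebraicGeometry
open scoped MonObj

universe u

/-- `Spec L` as a scheme over `Spec K`, for a field extension `L` of `K`. -/
noncomputable abbrev specOver (K L : Type u) [Field K] [Field L] [Algebra K L] :
    Over (Spec (.of K)) :=
  Over.mk (Spec.map (CommRingCat.ofHom (algebraMap K L)))

/-- The morphism `Spec M ⟶ Spec L` over `Spec K` given by a `K`-embedding `L → M`. -/
noncomputable def specOverMap {K L M : Type u} [Field K] [Field L] [Field M] [Algebra K L]
    [Algebra K M] (φ : L →ₐ[K] M) : specOver K M ⟶ specOver K L :=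
  Over.homMk (Spec.map (CommRingCat.ofHom φ.toRingHom)) (by
    simp only [specOver, Over.mk_hom, ← Spec.map_comp, ← CommRingCat.ofHom_comp]
    congr 2
    exact φ.comp_algebraMap)

/-- An abelian variety over the field `K`: a proper, geometrically integral group scheme
over `K`. -/
structure AbVar (K : Type u) [Field K] where
  /-- the underlying `K`-scheme -/
  X : Over (Spec (.of K))
  [grpObj : GrpObj X]
  [isProper : IsProper X.hom]
  [geometricallyIntegral : GeometricallyIntegral X.hom]

namespace AbVar

attribute [instance] grpObj isProper geometricallyIntegral

variable {K : Type u} [Field K] (A : AbVar K)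

instance : IsCommMonObj A.X := isCommMonObj_of_isProper_of_geometricallyIntegral A.X

/-! ### The endomorphism ring -/

/-- `End_K(A)`: the endomorphisms of `A` as a group scheme over `K`. -/
@[ext]
structure EndK where
  /-- the underlying morphism of `K`-schemes -/
  hom : A.X ⟶ A.X
  [isMonHom : IsMonHom hom]

attribute [instance] EndK.isMonHom

instance (f g : A.EndK) : IsMonHom (f.hom * g.hom) :=
  inferInstanceAs (IsMonHom (lift f.hom g.hom ≫ MonObj.mul (X := A.X)))

instance : IsMonHom (1 : A.X ⟶ A.X) :=
  inferInstanceAs (IsMonHom (toUnit A.X ≫ MonObj.one (X := A.X)))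

/-- Addition of endomorphisms is the pointwise group law of `A` (which Mathlib writes
multiplicatively). -/
noncomputable instance : AddCommGroup A.EndK :=
  letI : Zero A.EndK := ⟨⟨1⟩⟩
  letI : Add A.EndK := ⟨fun f g => ⟨f.hom * g.hom⟩⟩
  letI : Neg A.EndK := ⟨fun f => ⟨f.hom⁻¹⟩⟩
  { add_assoc := fun f g h => EndK.ext (mul_assoc f.hom g.hom h.hom)
    zero_add := fun f => EndK.ext (one_mul f.hom)
    add_zero := fun f => EndK.ext (mul_one f.hom)
    neg_add_cancel := fun f => EndK.ext (inv_mul_cancel f.hom)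
    add_comm := fun f g => EndK.ext (mul_comm f.hom g.hom)
    nsmul := nsmulRec
    zsmul := zsmulRec }

/-- The endomorphism ring: multiplication is composition. -/
noncomputable instance : Ring A.EndK :=
  { (inferInstance : AddCommGroup A.EndK) with
    mul := fun f g => ⟨g.hom ≫ f.hom⟩
    one := ⟨𝟙 _⟩
    mul_assoc := fun f g h => EndK.ext (Category.assoc h.hom g.hom f.hom).symm
    one_mul := fun f => EndK.ext (Category.comp_id f.hom)
    mul_one := fun f => EndK.ext (Category.id_comp f.hom)
    zero_mul := fun f => EndK.ext (MonObj.comp_one f.hom)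
    mul_zero := fun f => EndK.ext (MonObj.one_comp f.hom)
    left_distrib := fun f g h => EndK.ext (MonObj.mul_comp g.hom h.hom f.hom)
    right_distrib := fun f g h => EndK.ext (MonObj.comp_mul h.hom f.hom g.hom) }

/-! ### Rational points -/

/-- `A(L)`: the `L`-rational points of `A`, for a field extension `L` of `K`. -/
def Point (L : Type u) [Field L] [Algebra K L] : Type u := specOver K L ⟶ A.X

namespace Point

variable {A}
variable {L M N : Type u} [Field L] [Algebra K L] [Field M] [Algebra K M] [Field N] [Algebra K N]

/-- The group law on `A(L)`, written additively. -/
noncomputable instance : AddCommGroup (A.Point L) :=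
  inferInstanceAs (AddCommGroup (Additive (specOver K L ⟶ A.X)))

/-- An endomorphism `f` of `A` acts on `A(L)` by `x ↦ f ∘ x`. -/
noncomputable instance : Module A.EndK (A.Point L) where
  smul f x := (show specOver K L ⟶ A.X from x) ≫ f.hom
  one_smul x := Category.comp_id (show specOver K L ⟶ A.X from x)
  mul_smul f g x := (Category.assoc (show specOver K L ⟶ A.X from x) g.hom f.hom).symm
  smul_zero f := MonObj.one_comp (X := specOver K L) f.hom
  smul_add f x y := MonObj.mul_comp (X := specOver K L) x y f.hom
  add_smul f g x := MonObj.comp_mul (X := specOver K L) x f.hom g.hom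
  zero_smul x := MonObj.comp_one (X := specOver K L) (M := A.X) x

/-- The map `A(L) → A(M)` induced by a `K`-embedding `φ : L → M`. It is `End_K(A)`-linear. -/
noncomputable def map (φ : L →ₐ[K] M) : A.Point L →ₗ[A.EndK] A.Point M where
  toFun x := specOverMap φ ≫ (show specOver K L ⟶ A.X from x)
  map_add' x y := MonObj.comp_mul (specOverMap φ) (show specOver K L ⟶ A.X from x) y
  map_smul' f x :=
    (Category.assoc (specOverMap φ) (show specOver K L ⟶ A.X from x) f.hom).symm

lemma map_id (x : A.Point L) : map (AlgHom.id K L) x = x := by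
  have h : specOverMap (AlgHom.id K L) = 𝟙 _ := by
    ext1
    exact Spec.map_id _
  change specOverMap (AlgHom.id K L) ≫ (show specOver K L ⟶ A.X from x) = x
  rw [h]
  exact Category.id_comp _

lemma map_comp (ψ : M →ₐ[K] N) (φ : L →ₐ[K] M) (x : A.Point L) :
    map (ψ.comp φ) x = map ψ (map φ x) := by
  have h : specOverMap (ψ.comp φ) = specOverMap ψ ≫ specOverMap φ := by
    ext1
    exact Spec.map_comp (CommRingCat.ofHom φ.toRingHom) (CommRingCat.ofHom ψ.toRingHom)
  change specOverMap (ψ.comp φ) ≫ (show specOver K L ⟶ A.X from x) =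
    specOverMap ψ ≫ specOverMap φ ≫ (show specOver K L ⟶ A.X from x)
  rw [h, Category.assoc]

end Point

/-! ### Real multiplication and torsion

In this section the endomorphism ring of `A` is identified with a commutative ring `O` by an
isomorphism `e`. -/

section Torsion

variable {A}
variable {O : Type u} [CommRing O]

/-- `A(L)`, regarded as an `O`-module through `e : O ≃ End_K(A)`. -/
@[nolint unusedArguments]
def PointVia (_ : O ≃+* A.EndK) (L : Type u) [Field L] [Algebra K L] : Type u := A.Point L

variable (e : O ≃+* A.EndK) (I : Ideal O)
variable (L : Type u) [Field L] [Algebra K L]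

noncomputable instance : AddCommGroup (PointVia e L) := inferInstanceAs (AddCommGroup (A.Point L))

noncomputable instance : Module O (PointVia e L) :=
  Module.compHom (A.Point L) (e : O →+* A.EndK)

/-- `A[I](L)`: the points of `A(L)` that are killed by every element of the ideal `I`. It is
a module over `O ⧸ I`. -/
noncomputable abbrev torsion : Submodule O (PointVia e L) :=
  Submodule.torsionBySet O (PointVia e L) (I : Set O)

/-- The `O`-linear map `A(L) → A(L)` induced by a `K`-automorphism of `L`. -/
noncomputable def galMap (σ : L →ₐ[K] L) : PointVia e L →ₗ[O] PointVia e L where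
  toFun x := Point.map (A := A) σ x
  map_add' x y := (Point.map (A := A) σ).map_add x y
  map_smul' a x := (Point.map (A := A) σ).map_smul (e a) x

lemma galMap_mem_torsion (σ : L →ₐ[K] L) (x : PointVia e L) (hx : x ∈ torsion e I L) :
    galMap e L σ x ∈ torsion e I L := by
  rw [Submodule.mem_torsionBySet_iff] at hx ⊢
  intro a
  have h := congrArg (galMap e L σ) (hx a)
  rwa [map_zero, map_smul] at h

/-- The natural action of `Gal(L | F)` on `A[I](L)`, as an `O ⧸ I`-linear representation. Here
`L` is an extension of `F`, which is an extension of `K`. -/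
noncomputable def torsionRep (F : Type u) [Field F] [Algebra K F] [Algebra F L]
    [IsScalarTower K F L] : Representation (O ⧸ I) Gal(L/F) (torsion e I L) where
  toFun σ :=
    { toFun := fun x => ⟨galMap e L (σ.toAlgHom.restrictScalars K) x,
        galMap_mem_torsion e I L _ x x.2⟩
      map_add' := fun x y => Subtype.ext (map_add (galMap e L _) _ _)
      map_smul' := fun a x => by
        obtain ⟨a, rfl⟩ := Ideal.Quotient.mk_surjective a
        exact Subtype.ext (map_smul (galMap e L _) a (x : PointVia e L)) }
  map_one' := by
    refine LinearMap.ext fun x => Subtype.ext ?_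
    exact Point.map_id (A := A) _
  map_mul' σ τ := by
    refine LinearMap.ext fun x => Subtype.ext ?_
    exact Point.map_comp (A := A) (σ.toAlgHom.restrictScalars K) (τ.toAlgHom.restrictScalars K) _

/-- The representation `ρ_I` of the absolute Galois group of `K` on `A[I](K̄)`. -/
noncomputable abbrev galRep :
    Representation (O ⧸ I) Gal(AlgebraicClosure K/K) (torsion e I (AlgebraicClosure K)) :=
  torsionRep e I (AlgebraicClosure K) K

/-- The restriction of `ρ_I` to the absolute Galois group of `F`. -/
noncomputable def galRepRestrict (F : IntermediateField K (AlgebraicClosure K)) :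
    Representation (O ⧸ I) F.fixingSubgroup (torsion e I (AlgebraicClosure K)) :=
  (galRep e I).comp F.fixingSubgroup.subtype

/-- `F(A[I])`: the smallest extension of `F` inside `K̄` over which all points of `A[I](K̄)`
are defined. -/
noncomputable def torsionField (F : IntermediateField K (AlgebraicClosure K)) :
    IntermediateField K (AlgebraicClosure K) :=
  sInf {L | F ≤ L ∧ ∀ x ∈ torsion e I (AlgebraicClosure K),
    ∃ y : A.Point L, Point.map L.val y = x}

lemma le_torsionField (F : IntermediateField K (AlgebraicClosure K)) : F ≤ torsionField e I F :=
  le_sInf fun _ hL => hL.1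

/-- The field `F(A[I])` as an extension of `F`. -/
noncomputable abbrev torsionExt (F : IntermediateField K (AlgebraicClosure K)) :
    IntermediateField F (AlgebraicClosure K) :=
  IntermediateField.extendScalars (le_torsionField e I F)

/-- `A[I]` as a module under `Gal(F(A[I]) | F)`: the representation of this group on the
`F(A[I])`-rational points of `A[I]` (these are all points of `A[I]` over `K̄`). -/
noncomputable def torsionModule (F : IntermediateField K (AlgebraicClosure K)) :
    Rep (O ⧸ I) Gal(torsionExt e I F/F) :=
  Rep.of (torsionRep e I (torsionExt e I F) F)

end Torsion

/-! ### Abelian varieties of `GL₂`-type -/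

/-- A regular prime ideal: its local ring is a discrete valuation ring. -/
def IsRegularPrime {O : Type u} [CommRing O] (P : Ideal O) [P.IsPrime] : Prop :=
  ∃ _ : IsDomain (Localization.AtPrime P), IsDiscreteValuationRing (Localization.AtPrime P)

/-- `A` is of `GL₂`-type, with endomorphism ring `O` (via `e`): the ring `O` is an order in a
number field (namely in its field of fractions), and for every regular prime `P` of `O` and
every `n ≥ 1` the torsion module `A[P ^ n](K̄)` is free of rank `2` over `O ⧸ P ^ n`. -/
structure IsGL2Type {A : AbVar K} {O : Type u} [CommRing O] (e : O ≃+* A.EndK) : Prop where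
  isDomain : IsDomain O
  charZero : CharZero O
  finite : Module.Finite ℤ O
  free_torsion : ∀ (P : Ideal O) [P.IsPrime], IsRegularPrime P → ∀ n : ℕ, 1 ≤ n →
    Nonempty (Module.Basis (Fin 2) (O ⧸ P ^ n) (torsion e (P ^ n) (AlgebraicClosure K)))

/-! ### Absolutely simple abelian varieties -/

/-- The base change of an abelian variety to a field extension. -/
noncomputable def baseChange (L : Type u) [Field L] [Algebra K L] : AbVar L :=
  letI f := Spec.map (CommRingCat.ofHom (algebraMap K L))
  letI : GrpObj ((Over.pullback f).obj A.X) := Functor.grpObjObj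
  haveI : IsProper ((Over.pullback f).obj A.X).hom := by dsimp; infer_instance
  haveI : GeometricallyIntegral ((Over.pullback f).obj A.X).hom := by dsimp; infer_instance
  ⟨(Over.pullback f).obj A.X⟩

/-- `A` has positive dimension. -/
def PosDim : Prop := 0 < topologicalKrullDim A.X.left

/-- An isogeny: a finite surjective homomorphism of group schemes. -/
structure IsIsogeny {G H : Over (Spec (.of K))} [GrpObj G] [GrpObj H] (f : G ⟶ H) : Prop where
  isMonHom : IsMonHom f
  isFinite : IsFinite f.left
  surjective : Surjective f.left

/-- `A` is absolutely simple: it has positive dimension, and over the algebraic closure it is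
not isogenous to a product of two abelian varieties of positive dimension. -/
def IsAbsolutelySimple : Prop :=
  A.PosDim ∧ ∀ B C : AbVar (AlgebraicClosure K), B.PosDim → C.PosDim →
    ¬ ∃ f : (A.baseChange (AlgebraicClosure K)).X ⟶ B.X ⊗ C.X, IsIsogeny f

end AbVar

/-! ### Subgroups of `GL₂` -/

/-- The natural representation of a subgroup `G` of `GL₂(F)` on `F²`. -/
noncomputable def standardRep {F : Type u} [Field F] (G : Subgroup (GL (Fin 2) F)) :
    Representation F G (Fin 2 → F) :=
  (((Matrix.toLinAlgEquiv' (R := F) (n := Fin 2)).toAlgHom : _ →* _).comp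
    (Units.coeHom (Matrix (Fin 2) (Fin 2) F))).comp G.subtype

/-- `G` fixes the line `l` of `F²`, as a set. -/
def FixesLine {F : Type u} [Field F] (G : Subgroup (GL (Fin 2) F))
    (l : Submodule F (Fin 2 → F)) : Prop :=
  Module.finrank F l = 1 ∧ ∀ g ∈ G, ∀ v ∈ l, (g : Matrix (Fin 2) (Fin 2) F).mulVec v ∈ l

/-! Let `G` act faithfully on a plane over a finite field of odd characteristic `p`. If `p` does not
divide `|G|`, averaging a cocycle kills `H¹`; if `-1 ∈ G`, comparing a cocycle at `(-1)g` and
`g(-1)` kills it. `exists_neg_one_or_existsUnique_line` shows that in every other case `G`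
stabilizes exactly one line.

For this, take `u ∈ G` of order `p`; it is unipotent and fixes a vector `v`. Let `H` be the subgroup
of determinant `1`. An involution of determinant `1` is `-1`, so `H` may be assumed to have odd
order. The heart of the proof is `upperTriangular_of_odd`: then `H` stabilizes the line of `v`. The
elements of `p`-power order are the conjugates of the unitriangular subgroup `Q`. For any other
nontrivial `x`, the centralizer is its own normalizer and meets its other conjugates trivially,
since an element normalizing it would have to invert something, which odd order forbids. The
conjugates of each such centralizer fill at least half of `H`, so there is at most one class of
them, and counting elements in `Subgroup.eq_top_of_partition` forces the triangular subgroup `N` to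
be all of `H`. Finally `H` is normal in `G` and `v` spans the only line fixed by `u`, so `G`
stabilizes that line and no other.

For the second part, `Gal(F(A[P])|F)` acts faithfully on the plane `A[P]`, and irreducibility leaves
no stable line, so the same criterion applies. The Galois theory of points rests on one fact: an
`L`-valued point of a scheme is a map from a residue field to `L`, and its image decides over which
subfields the point is defined. -/

/-! ### Counting conjugates in a finite group. -/

/-- The nontrivial elements that are conjugate to an element of the subgroup `C`. -/
def Subgroup.conjSet {H : Type*} [Group H] (C : Subgroup H) : Set H :=
  {x | ∃ g : H, ∃ c ∈ C, c ≠ 1 ∧ x = g * c * g⁻¹}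

lemma Subgroup.one_notMem_conjSet {H : Type*} [Group H] (C : Subgroup H) : 1 ∉ C.conjSet := by
  rintro ⟨g, c, -, hc, h⟩
  exact hc (by simpa using h.symm)

lemma Subgroup.mem_conjSet_conj {H : Type*} [Group H] {C : Subgroup H} {x : H}
    (hx : x ∈ C.conjSet) (g : H) : g * x * g⁻¹ ∈ C.conjSet := by
  obtain ⟨a, c, hc, h1, rfl⟩ := hx
  exact ⟨g * a, c, hc, h1, by group⟩

/-- If `C` has trivial intersection with its other conjugates, and normalizer `N`, then its
conjugates contain `[H : N] (|C| - 1)` nontrivial elements. -/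
lemma Subgroup.ncard_conjSet_mul {H : Type*} [Group H] [Finite H] (C N : Subgroup H)
    (hTI : ∀ g, ∀ x ∈ C, x ≠ 1 → g * x * g⁻¹ ∈ C → g ∈ N)
    (hN : ∀ n ∈ N, ∀ c ∈ C, n * c * n⁻¹ ∈ C) :
    C.conjSet.ncard * Nat.card N = Nat.card H * (Nat.card C - 1) := by
  classical
  have key : C.conjSet.ncard = Nat.card (H ⧸ N) * (Nat.card C - 1) := by
    have h1 : Nat.card C - 1 = Nat.card {c : C // c ≠ 1} := by
      have := Nat.card_congr (Equiv.sumCompl (fun c : C => c = 1))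
      rw [Nat.card_sum] at this
      simp only [Nat.card_unique] at this
      rw [← this]
      simp
    rw [h1, ← Nat.card_prod, ← Nat.card_coe_set_eq]
    symm
    refine Nat.card_congr (Equiv.ofBijective
      (fun y : (H ⧸ N) × {c : C // c ≠ 1} => (⟨y.1.out * y.2.1 * y.1.out⁻¹,
        y.1.out, y.2.1, y.2.1.2, fun h => y.2.2 (Subtype.ext h), rfl⟩ : C.conjSet)) ⟨?_, ?_⟩)
    · rintro ⟨a, ⟨⟨c, hc⟩, hc1⟩⟩ ⟨b, ⟨⟨d, hd⟩, hd1⟩⟩ h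
      replace h : a.out * c * a.out⁻¹ = b.out * d * b.out⁻¹ := congrArg Subtype.val h
      have hab : a = b := by
        rw [← QuotientGroup.out_eq' a, ← QuotientGroup.out_eq' b, eq_comm, QuotientGroup.eq]
        refine hTI _ c hc (fun h => hc1 (Subtype.ext h)) ?_
        have : b.out⁻¹ * a.out * c * (b.out⁻¹ * a.out)⁻¹ = d := by
          rw [show b.out⁻¹ * a.out * c * (b.out⁻¹ * a.out)⁻¹
            = b.out⁻¹ * (a.out * c * a.out⁻¹) * b.out by group, h]
          group
        rw [this]
        exact hd
      subst hab
      have : c = d := by simpa using h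
      subst this
      rfl
    · rintro ⟨x, g, c, hc, hc1, rfl⟩
      -- The chosen representative of the coset of `g` is `g * n`, so `c` has to be twisted by
      -- `n⁻¹`.
      obtain ⟨n, hn⟩ := QuotientGroup.mk_out_eq_mul N g
      refine ⟨⟨(g : H ⧸ N), ⟨⟨(n : H)⁻¹ * c * n, ?_⟩, ?_⟩⟩, ?_⟩
      · simpa using hN _ (N.inv_mem n.2) c hc
      · intro h
        apply hc1
        have h := congrArg Subtype.val h
        simp only [Subgroup.coe_one] at h
        calc c = n * ((n : H)⁻¹ * c * n) * (n : H)⁻¹ := by group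
          _ = 1 := by rw [h]; group
      · simp only [hn]
        group
  rw [key, Subgroup.card_eq_card_quotient_mul_card_subgroup N]
  ring

/-- The counting argument for a group that is partitioned by the conjugates of `Q` and by
self-normalizing abelian centralizers. -/
theorem Subgroup.eq_top_of_partition {H : Type*} [Group H] [Finite H] (Q N : Subgroup H)
    (hQ : Q ≠ ⊥) (hQN : Q ≤ N)
    (hTI : ∀ x, x ≠ 1 → x ∉ Q.conjSet → ∀ g y, y * x = x * y → y ≠ 1 →
      (g * y * g⁻¹) * x = x * (g * y * g⁻¹) → g * x = x * g)
    (hQTI : ∀ g, ∀ x ∈ Q, x ≠ 1 → g * x * g⁻¹ ∈ Q → g ∈ N)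
    (hNQ : ∀ n ∈ N, ∀ c ∈ Q, n * c * n⁻¹ ∈ Q)
    (hcomm : ∀ a ∈ N, ∀ b ∈ N, a * b * a⁻¹ * b⁻¹ ∈ Q)
    (hcent : ∀ y ∈ Q, y ≠ 1 → ∀ x, x * y = y * x → x ∈ Q)
    (hmem : ∀ x ∈ N, x ∈ Q.conjSet → x ∈ Q) : N = ⊤ := by
  set h := Nat.card H with hh
  set q := Nat.card Q with hq
  have hq2 : 2 ≤ q := by
    have := (Subgroup.one_lt_card_iff_ne_bot Q).2 hQ
    omega
  have hU : Q.conjSet.ncard * Nat.card N = h * (q - 1) := Q.ncard_conjSet_mul N hQTI hNQ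
  have mem_cent : ∀ x y : H, y ∈ Subgroup.centralizer {x} ↔ y * x = x * y := fun x y => by
    rw [Subgroup.mem_centralizer_singleton_iff]
  have hC : ∀ x, x ≠ 1 → x ∉ Q.conjSet → 2 ≤ Nat.card (Subgroup.centralizer {x}) ∧
      (Subgroup.centralizer {x}).conjSet.ncard * Nat.card (Subgroup.centralizer {x}) =
        h * (Nat.card (Subgroup.centralizer {x}) - 1) := by
    intro x hx hxU
    constructor
    · have : Subgroup.centralizer {x} ≠ ⊥ := fun h0 => hx <| by
        rw [← Subgroup.mem_bot, ← h0, mem_cent]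
      have := (Subgroup.one_lt_card_iff_ne_bot _).2 this
      omega
    · refine Subgroup.ncard_conjSet_mul _ _ ?_ ?_
      · intro g y hy hy1 hg
        rw [mem_cent] at *
        exact hTI x hx hxU g y hy hy1 hg
      · intro n hn c hc
        exact Subgroup.mul_mem _ (Subgroup.mul_mem _ hn hc) (Subgroup.inv_mem _ hn)
  have hdisj : ∀ x, x ≠ 1 → x ∉ Q.conjSet →
      Disjoint Q.conjSet (Subgroup.centralizer {x}).conjSet := by
    intro x hx hxU
    rw [Set.disjoint_left]
    rintro _ hy ⟨g, c, hc, hc1, rfl⟩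
    rw [mem_cent] at hc
    have hcU : c ∈ Q.conjSet := by
      have := Subgroup.mem_conjSet_conj hy g⁻¹
      convert this using 1
      group
    obtain ⟨a, d, hd, hd1, rfl⟩ := hcU
    have h1 : (a⁻¹ * x * a) ∈ Q := by
      refine hcent d hd hd1 _ ?_
      have : a⁻¹ * x * a * d = a⁻¹ * (x * (a * d * a⁻¹)) * a := by group
      rw [this, ← hc]
      group
    refine hxU ⟨a, _, h1, ?_, by group⟩
    intro h2
    apply hx
    calc x = a * (a⁻¹ * x * a) * a⁻¹ := by group
      _ = 1 := by rw [h2]; group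
  -- The proportion `(c - 1) / c` is at least one half. Two disjoint families of this kind, together
  -- with the identity, would therefore exceed `h`.
  have hhalf : ∀ n c : ℕ, 2 ≤ c → n * c = h * (c - 1) → h ≤ 2 * n := by
    intro n c hc hn
    obtain ⟨c, rfl⟩ := Nat.exists_eq_add_of_le hc
    have : 2 + c - 1 = c + 1 := by omega
    rw [this] at hn
    by_contra hlt
    nlinarith
  have hsum2 : ∀ S T : Set H, Disjoint S T → 1 ∉ S → 1 ∉ T → S.ncard + T.ncard + 1 ≤ h := by
    intro S T hST hS hT
    have h1 : (S ∪ T ∪ {1}).ncard = S.ncard + T.ncard + 1 := by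
      rw [Set.ncard_union_eq (by simp [hS, hT]), Set.ncard_union_eq hST, Set.ncard_singleton]
    rw [← h1, hh, ← Set.ncard_univ]
    exact Set.ncard_le_ncard (Set.subset_univ _)
  have hcover : ∀ x, x ≠ 1 → x ∉ Q.conjSet → ∀ y, y ≠ 1 → y ∉ Q.conjSet →
      y ∈ (Subgroup.centralizer {x}).conjSet := by
    intro x hx hxU y hy hyU
    by_contra hyx
    have hd : Disjoint (Subgroup.centralizer {x}).conjSet
        (Subgroup.centralizer {y}).conjSet := by
      rw [Set.disjoint_left]
      rintro _ ⟨a, c, hc, hc1, rfl⟩ ⟨b, d, hd, hd1, hcd⟩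
      -- If conjugates of the two centralizers share a nontrivial element, the TI property puts a
      -- conjugate of `x` into the centralizer of `y`, and so `y` into a conjugate of the
      -- centralizer of `x`.
      rw [mem_cent] at hc hd
      set e := b⁻¹ * a with he
      have hd' : d = e * c * e⁻¹ := by
        rw [he, show b⁻¹ * a * c * (b⁻¹ * a)⁻¹ = b⁻¹ * (a * c * a⁻¹) * b by group, hcd]
        group
      have hcm : (e * x * e⁻¹) * d = d * (e * x * e⁻¹) := by
        rw [hd', show e * x * e⁻¹ * (e * c * e⁻¹) = e * (x * c) * e⁻¹ by group, ← hc]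
        group
      have h2 := hTI y hy hyU (e * x * e⁻¹) d hd hd1 (by rw [hcm, mul_inv_cancel_right]; exact hd)
      refine hyx ⟨e, e⁻¹ * y * e, ?_, ?_, by group⟩
      · rw [mem_cent]
        calc e⁻¹ * y * e * x = e⁻¹ * (y * (e * x * e⁻¹)) * e := by group
          _ = _ := by rw [← h2]; group
      · intro h3
        apply hy
        calc y = e * (e⁻¹ * y * e) * e⁻¹ := by group
          _ = 1 := by rw [h3]; group
    obtain ⟨c1, hc1⟩ := hC x hx hxU
    obtain ⟨c2, hc2⟩ := hC y hy hyU
    have := hhalf _ _ c1 hc1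
    have := hhalf _ _ c2 hc2
    have := hsum2 _ _ hd (Subgroup.one_notMem_conjSet _) (Subgroup.one_notMem_conjSet _)
    omega
  suffices hle : h ≤ Nat.card N from Subgroup.eq_top_of_le_card _ hle
  by_cases hNle : N ≤ Q
  · obtain rfl : N = Q := le_antisymm hNle hQN
    -- When `N = Q`, the conjugates of `Q` already fill half of the group. No other class fits, so
    -- `h = |U| + 1`, which gives `h = q`.
    by_cases hS : ∃ x, x ≠ 1 ∧ x ∉ N.conjSet
    · obtain ⟨x, hx, hxU⟩ := hS
      obtain ⟨c1, hc1⟩ := hC x hx hxU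
      have := hhalf _ _ c1 hc1
      have := hhalf _ _ hq2 hU
      have := hsum2 _ _ (hdisj x hx hxU) (Subgroup.one_notMem_conjSet _)
        (Subgroup.one_notMem_conjSet _)
      omega
    · push Not at hS
      have : h ≤ N.conjSet.ncard + 1 := by
        rw [hh, ← Set.ncard_univ]
        refine (Set.ncard_le_ncard (t := insert 1 N.conjSet) ?_).trans (Set.ncard_insert_le _ _)
        intro x _
        by_cases hx : x = 1
        · exact Or.inl hx
        · exact Or.inr (hS x hx)
      rw [← hq] at hU ⊢
      obtain ⟨q', hq'⟩ := Nat.exists_eq_add_of_le hq2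
      rw [hq'] at hU ⊢
      have h1 : 2 + q' - 1 = q' + 1 := by omega
      rw [h1] at hU
      nlinarith
  · obtain ⟨x, hxN, hxQ⟩ := Set.not_subset.1 hNle
    have hx : x ≠ 1 := fun h1 => hxQ (h1 ▸ Q.one_mem)
    have hxU : x ∉ Q.conjSet := fun h1 => hxQ (hmem x hxN h1)
    obtain ⟨hc2, hc⟩ := hC x hx hxU
    have hle := hsum2 _ _ (hdisj x hx hxU) (Subgroup.one_notMem_conjSet _)
        (Subgroup.one_notMem_conjSet _)
    have hge : h ≤ Q.conjSet.ncard + (Subgroup.centralizer {x}).conjSet.ncard + 1 := by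
      rw [hh, ← Set.ncard_univ]
      refine (Set.ncard_le_ncard
        (t := insert 1 (Q.conjSet ∪ (Subgroup.centralizer {x}).conjSet)) ?_).trans
        ((Set.ncard_insert_le _ _).trans (by gcongr; exact Set.ncard_union_le _ _))
      intro y _
      by_cases hy : y = 1
      · exact Or.inl hy
      · by_cases hyU : y ∈ Q.conjSet
        · exact Or.inr (Or.inl hyU)
        · exact Or.inr (Or.inr (hcover x hx hxU y hy hyU))
    set C := Subgroup.centralizer {x} with hCdef
    set D := C ⊓ N with hD
    -- `D` is a complement of `Q` in `N`: the commutator with `x` embeds the cosets of `D` into `Q`,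
    -- while `D ∩ Q` is trivial because an element of it other than `1` would force `x ∈ Q`.
    have hcard : Nat.card N = Nat.card D * q := by
      apply le_antisymm
      · rw [Subgroup.card_eq_card_quotient_mul_card_subgroup (D.subgroupOf N), mul_comm,
          Nat.card_congr (Subgroup.subgroupOfEquivOfLe (inf_le_right : D ≤ N)).toEquiv]
        gcongr
        refine Nat.card_le_card_of_injective
          (fun a : N ⧸ D.subgroupOf N =>
            (⟨_, hcomm _ a.out.2 x hxN⟩ : Q)) ?_
        intro a b hab
        simp only [Subtype.mk.injEq] at hab
        rw [← QuotientGroup.out_eq' a, ← QuotientGroup.out_eq' b, QuotientGroup.eq,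
          Subgroup.mem_subgroupOf]
        refine Subgroup.mem_inf.2 ⟨?_, SetLike.coe_mem _⟩
        rw [hCdef, mem_cent]
        have hab := mul_right_cancel hab
        push_cast
        rw [show (a.out : H)⁻¹ * b.out * x =
          (a.out : H)⁻¹ * (b.out * x * (b.out : H)⁻¹) * b.out by group, ← hab]
        group
      · rw [hq, ← Nat.card_prod]
        refine Nat.card_le_card_of_injective
          (fun a : D × Q => (⟨a.1 * a.2, N.mul_mem a.1.2.2 (hQN a.2.2)⟩ : N)) ?_
        rintro ⟨⟨a, ha⟩, ⟨b, hb⟩⟩ ⟨⟨c, hc⟩, ⟨d, hd⟩⟩ habcd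
        simp only [Subtype.mk.injEq] at habcd
        have e1 : c⁻¹ * a = d * b⁻¹ := by
          rw [inv_mul_eq_iff_eq_mul, ← mul_assoc, ← habcd]; group
        have e2 : c⁻¹ * a = 1 := by
          by_contra hne
          have hQ' : c⁻¹ * a ∈ Q := e1 ▸ Q.mul_mem hd (Q.inv_mem hb)
          have hC' : c⁻¹ * a ∈ C := C.mul_mem (C.inv_mem hc.1) ha.1
          rw [hCdef, mem_cent] at hC'
          exact hxQ (hcent _ hQ' hne x hC'.symm)
        have e3 : a = c := by rw [inv_mul_eq_one] at e2; exact e2.symm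
        subst e3
        have := mul_left_cancel habcd
        subst this
        rfl
    obtain ⟨m, hm⟩ : Nat.card D ∣ Nat.card C := Subgroup.card_dvd_of_le inf_le_left
    have hd0 : 0 < Nat.card D := Nat.card_pos
    rw [hcard] at hU ⊢
    rw [hm] at hc hc2
    set d := Nat.card D
    set U := Q.conjSet.ncard
    set S := C.conjSet.ncard
    zify [show 1 ≤ q by omega, show 1 ≤ d * m by omega] at *
    have hm0 : 1 ≤ m := by
      rcases Nat.eq_zero_or_pos m with h0 | h0
      · subst h0; simp at hc2
      · exact h0
    have heq : (U : ℤ) + S + 1 = h := le_antisymm hle hge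
    have e : (m : ℤ) * (h * (q - 1)) + q * (h * (d * m - 1)) = (h - 1) * (d * q * m) := by
      rw [← hU, ← hc, ← heq]; ring
    -- This is `|U| + |S| + 1 = h` with denominators cleared. As `q ≥ 2`, any `m ≥ 2` makes the left
    -- side nonpositive; `m = 1` gives `h = d * q = |N|`.
    have e' : (h : ℤ) * (q + m - q * m) = d * q * m := by linear_combination -e
    rcases Nat.eq_or_lt_of_le hm0 with h1 | h1
    · subst h1
      push_cast at e'
      linarith
    · exfalso
      have h3 : (0 : ℤ) < d * q * m := by positivity
      have h4 : (q + m - q * m : ℤ) ≤ 0 := by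
        have : (2 : ℤ) ≤ m := by exact_mod_cast h1
        nlinarith
      have h5 : (0 : ℤ) ≤ h := by positivity
      nlinarith

/-! ### Odd-order groups of `2 × 2` matrices of determinant one. -/

section TwoByTwo

variable {k : Type*} [Field k]

/-- A matrix that commutes with a nonscalar `2 × 2` matrix is a linear polynomial in it. -/
lemma Matrix.exists_eq_add_smul_of_commute {X Y : Matrix (Fin 2) (Fin 2) k}
    (hX : ¬ (X 0 1 = 0 ∧ X 1 0 = 0 ∧ X 0 0 = X 1 1)) (h : Y * X = X * Y) :
    ∃ a b : k, Y = a • 1 + b • X := by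
  have e00 := congrFun (congrFun h 0) 0
  have e01 := congrFun (congrFun h 0) 1
  have e10 := congrFun (congrFun h 1) 0
  simp only [Matrix.mul_apply, Fin.sum_univ_two] at e00 e01 e10
  by_cases h01 : X 0 1 = 0
  · by_cases h10 : X 1 0 = 0
    · have hd : X 0 0 - X 1 1 ≠ 0 := fun h0 => hX ⟨h01, h10, sub_eq_zero.1 h0⟩
      rw [h01] at e01
      rw [h10] at e10
      have y01 : Y 0 1 = 0 := (mul_eq_zero.1 (by linear_combination -e01 :
        (X 0 0 - X 1 1) * Y 0 1 = 0)).resolve_left hd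
      have y10 : Y 1 0 = 0 := (mul_eq_zero.1 (by linear_combination e10 :
        (X 0 0 - X 1 1) * Y 1 0 = 0)).resolve_left hd
      refine ⟨Y 0 0 - (Y 0 0 - Y 1 1) / (X 0 0 - X 1 1) * X 0 0,
        (Y 0 0 - Y 1 1) / (X 0 0 - X 1 1), ?_⟩
      ext i j
      fin_cases i <;> fin_cases j <;> simp [h01, h10, y01, y10]
      field_simp
      ring
    · refine ⟨Y 0 0 - Y 1 0 / X 1 0 * X 0 0, Y 1 0 / X 1 0, ?_⟩
      ext i j
      fin_cases i <;> fin_cases j <;> simp <;> field_simp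
      · linear_combination e00
      · linear_combination e10
  · refine ⟨Y 0 0 - Y 0 1 / X 0 1 * X 0 0, Y 0 1 / X 0 1, ?_⟩
    ext i j
    fin_cases i <;> fin_cases j <;> simp <;> field_simp
    · linear_combination -e00
    · linear_combination -e01

/-- In a finite group of odd order, an element that is conjugated to its inverse is trivial. -/
lemma eq_one_of_conj_eq_inv {H : Type*} [Group H] [Finite H] (hodd : Odd (Nat.card H))
    {g y : H} (h : g * y * g⁻¹ = y⁻¹) : y = 1 := by
  -- In odd order `g` is a power of `g ^ 2`, so it commutes with `y` as well, and `y` equals its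
  -- inverse.
  have h2 : Commute (g ^ 2) y := by
    have : g ^ 2 * y * (g ^ 2)⁻¹ = y := by
      rw [show g ^ 2 * y * (g ^ 2)⁻¹ = g * (g * y * g⁻¹) * g⁻¹ by rw [pow_two]; group, h,
        show g * y⁻¹ * g⁻¹ = (g * y * g⁻¹)⁻¹ by group, h, inv_inv]
    exact mul_inv_eq_iff_eq_mul.1 this
  obtain ⟨m, hm⟩ := hodd
  have h3 : Commute g y := by
    have : g = (g ^ 2) ^ (m + 1) := by
      rw [← pow_mul, show 2 * (m + 1) = Nat.card H + 1 by omega, pow_succ, pow_card_eq_one',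
        one_mul]
    rw [this]
    exact h2.pow_left _
  rw [h3.eq, mul_inv_cancel_right] at h
  have h4 : y ^ 2 = 1 := by rw [pow_two]; nth_rewrite 1 [h]; simp
  calc y = y ^ (2 * m + 1) := by rw [pow_succ, pow_mul, h4]; simp
    _ = 1 := by rw [← hm, pow_card_eq_one']

lemma Matrix.entry_eq_of_mul_eq {A B C D : Matrix (Fin 2) (Fin 2) k} (h : A * B = C * D)
    (i j : Fin 2) : A i 0 * B 0 j + A i 1 * B 1 j = C i 0 * D 0 j + C i 1 * D 1 j := by
  simpa [Matrix.mul_apply, Fin.sum_univ_two] using congrFun (congrFun h i) j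

/-- A finite group of odd order of matrices of determinant `1` that contains a nontrivial upper
unitriangular matrix consists of upper triangular matrices. -/
theorem upperTriangular_of_odd (p : ℕ) [Fact p.Prime] [CharP k p] (hp : p ≠ 2)
    {H : Type*} [Group H] [Finite H]
    (hodd : Odd (Nat.card H)) (f : H →* Matrix (Fin 2) (Fin 2) k) (hf : Function.Injective f)
    (hdet : ∀ g, (f g).det = 1) (u : H) (hu1 : u ≠ 1) (h00 : f u 0 0 = 1) (h10 : f u 1 0 = 0)
    (h11 : f u 1 1 = 1) (g : H) : f g 1 0 = 0 := by
  have two : (2 : k) ≠ 0 := Ring.two_ne_zero (by rwa [ringChar.eq k p])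
  have d : ∀ g, f g 0 0 * f g 1 1 - f g 0 1 * f g 1 0 = 1 := fun g => by
    rw [← Matrix.det_fin_two]; exact hdet g
  have fm : ∀ a b i j, f (a * b) i j = f a i 0 * f b 0 j + f a i 1 * f b 1 j := fun a b i j => by
    rw [map_mul, Matrix.mul_apply, Fin.sum_univ_two]
  have finv : ∀ g, f g⁻¹ = !![f g 1 1, - f g 0 1; - f g 1 0, f g 0 0] := fun g => by
    rw [← Matrix.adjugate_fin_two]
    have h1 : f g⁻¹ * f g = 1 := by rw [← map_mul]; simp
    calc f g⁻¹ = f g⁻¹ * (f g * (f g).adjugate) := by rw [Matrix.mul_adjugate, hdet]; simp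
      _ = _ := by rw [← mul_assoc, h1, one_mul]
  have i00 : ∀ g, f g⁻¹ 0 0 = f g 1 1 := fun g => by rw [finv]; rfl
  have i01 : ∀ g, f g⁻¹ 0 1 = - f g 0 1 := fun g => by rw [finv]; rfl
  have i10 : ∀ g, f g⁻¹ 1 0 = - f g 1 0 := fun g => by rw [finv]; rfl
  have i11 : ∀ g, f g⁻¹ 1 1 = f g 0 0 := fun g => by rw [finv]; rfl
  have feq : ∀ a b, f a 0 0 = f b 0 0 → f a 0 1 = f b 0 1 → f a 1 0 = f b 1 0 →
      f a 1 1 = f b 1 1 → a = b := fun a b h1 h2 h3 h4 => hf <| by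
    ext i j; fin_cases i <;> fin_cases j <;> assumption
  have o00 : f 1 0 0 = 1 := by simp
  have o01 : f 1 0 1 = 0 := by simp
  have o10 : f 1 1 0 = 0 := by simp
  have o11 : f 1 1 1 = 1 := by simp
  have trconj : ∀ g x, f (g * x * g⁻¹) 0 0 + f (g * x * g⁻¹) 1 1 = f x 0 0 + f x 1 1 := by
    intro g x
    simp only [fm, i00, i01, i10, i11]
    linear_combination (f x 0 0 + f x 1 1) * d g
  -- trace `-2` does not occur
  have trneg : ∀ g, f g 0 0 + f g 1 1 ≠ -2 := by
    intro g hg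
    obtain ⟨m, hm⟩ := hodd
    -- `y` is a square root of `g`, so `tr g = (tr y)² - 2`. Trace `-2` gives `tr y = 0`, hence `g =
    -- y² = -1` by Cayley–Hamilton, contradicting odd order.
    set y := g ^ (m + 1) with hy
    have hgy : g = y * y := by
      rw [hy, ← pow_add, show m + 1 + (m + 1) = Nat.card H + 1 by omega, pow_succ,
        pow_card_eq_one', one_mul]
    have ht : f y 0 0 + f y 1 1 = 0 := by
      rw [hgy, fm, fm] at hg
      have : (f y 0 0 + f y 1 1) ^ 2 = 0 := by linear_combination hg + 2 * d y
      exact pow_eq_zero_iff (two_ne_zero) |>.1 this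
    have hy3 : f (y * y) = -1 := by
      ext i j
      rw [fm]
      fin_cases i <;> fin_cases j <;> simp
      · linear_combination f y 0 0 * ht - d y
      · linear_combination f y 0 1 * ht
      · linear_combination f y 1 0 * ht
      · linear_combination f y 1 1 * ht - d y
    have hg2 : g ^ 2 = 1 := hf <| by rw [map_pow, hgy, hy3]; simp
    have hg1 : g = 1 := by
      calc g = g ^ (2 * m + 1) := by rw [pow_succ, pow_mul, hg2]; simp
        _ = 1 := by rw [← hm, pow_card_eq_one']
    rw [hg1, o00, o11] at hg
    have h4 : (2 : k) * 2 = 0 := by linear_combination hg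
    simp [two] at h4
  -- A scalar matrix of determinant `1` is `±1`, and `-1` has trace `-2`.
  have trtwo : ∀ g, f g 0 1 = 0 ∧ f g 1 0 = 0 ∧ f g 0 0 = f g 1 1 → g = 1 := by
    rintro g ⟨h1, h2, h3⟩
    have h4 := d g
    rw [h1, ← h3] at h4
    have : (f g 0 0 - 1) * (f g 0 0 + 1) = 0 := by linear_combination h4
    rcases mul_eq_zero.1 this with h5 | h5
    · refine feq _ _ ?_ ?_ ?_ ?_ <;> simp only [o00, o01, o10, o11, h1, h2, ← h3] <;>
        linear_combination h5
    · refine absurd ?_ (trneg g)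
      rw [← h3]; linear_combination 2 * h5
  let N : Subgroup H :=
    { carrier := {g | f g 1 0 = 0}
      one_mem' := o10
      mul_mem' := fun {a b} (ha : f a 1 0 = 0) (hb : f b 1 0 = 0) => by
        simp [fm, ha, hb]
      inv_mem' := fun {a} (ha : f a 1 0 = 0) => by simp [i10, ha] }
  have memN : ∀ {g}, g ∈ N ↔ f g 1 0 = 0 := Iff.rfl
  let Q : Subgroup H :=
    { carrier := {g | f g 1 0 = 0 ∧ f g 0 0 = 1 ∧ f g 1 1 = 1}
      one_mem' := ⟨o10, o00, o11⟩
      mul_mem' := fun {a b} ⟨a1, a2, a3⟩ ⟨b1, b2, b3⟩ => by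
        simp [fm, a1, a2, a3, b1, b2, b3]
      inv_mem' := fun {a} ⟨a1, a2, a3⟩ => by simp [i10, i00, i11, a1, a2, a3] }
  have memQ : ∀ {g}, g ∈ Q ↔ f g 1 0 = 0 ∧ f g 0 0 = 1 ∧ f g 1 1 = 1 := Iff.rfl
  have Q01 : ∀ {g}, g ∈ Q → g ≠ 1 → f g 0 1 ≠ 0 := fun {g} hg h1 h0 =>
    h1 (trtwo g ⟨h0, hg.1, hg.2.1.trans hg.2.2.symm⟩)
  have hcent : ∀ y ∈ Q, y ≠ 1 → ∀ x, x * y = y * x → x ∈ Q := by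
    intro y hy hy1 x hxy
    have hb := Q01 hy hy1
    obtain ⟨y1, y2, y3⟩ := hy
    have e := Matrix.entry_eq_of_mul_eq (by rw [← map_mul, ← map_mul, hxy] :
      f x * f y = f y * f x)
    have e00 := e 0 0
    have e01 := e 0 1
    rw [y1, y2] at e00
    rw [y2, y3] at e01
    have x10 : f x 1 0 = 0 := (mul_eq_zero.1 (by linear_combination -e00 :
      f y 0 1 * f x 1 0 = 0)).resolve_left hb
    have x01 : f x 0 0 = f x 1 1 := sub_eq_zero.1 <| (mul_eq_zero.1 (by linear_combination e01 :
      f y 0 1 * (f x 0 0 - f x 1 1) = 0)).resolve_left hb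
    have hd := d x
    rw [x10, ← x01] at hd
    have : (f x 0 0 - 1) * (f x 0 0 + 1) = 0 := by linear_combination hd
    rcases mul_eq_zero.1 this with h5 | h5
    · exact ⟨x10, sub_eq_zero.1 h5, x01 ▸ sub_eq_zero.1 h5⟩
    · refine absurd ?_ (trneg x)
      rw [← x01]; linear_combination 2 * h5
  have huQ : u ∈ Q := ⟨h10, h00, h11⟩
  have hQ : Q ≠ ⊥ := fun h => hu1 (by rw [← Subgroup.mem_bot, ← h]; exact huQ)
  -- elements of `p`-power order are those of trace `2`
  have trp : ∀ g, (∃ n, g ^ p ^ n = 1) ↔ f g 0 0 + f g 1 1 = 2 := by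
    intro g
    constructor
    · rintro ⟨n, hn⟩
      have h1 : (f g - 1) ^ p ^ n = 0 := by
        have : ExpChar (Matrix (Fin 2) (Fin 2) k) p := by
          have : CharP (Matrix (Fin 2) (Fin 2) k) p := inferInstance
          exact ExpChar.prime (Fact.out)
        rw [sub_pow_expChar_pow_of_commute _ _ (Commute.one_right _), ← map_pow, hn]
        simp
      have h2 : (f g - 1).det = 0 := by
        have := congrArg Matrix.det h1
        rw [Matrix.det_pow, Matrix.det_zero] at this
        exact pow_eq_zero_iff (pow_ne_zero _ (Fact.out : p.Prime).ne_zero) |>.1 this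
      rw [Matrix.det_fin_two] at h2
      simp at h2
      linear_combination d g - h2
    · intro ht
      refine ⟨1, hf ?_⟩
      have h1 : (f g - 1) ^ 2 = 0 := by
        rw [pow_two]
        ext i j
        simp only [Matrix.mul_apply, Fin.sum_univ_two]
        fin_cases i <;> fin_cases j <;> simp
        · linear_combination f g 0 0 * ht - d g
        · linear_combination f g 0 1 * ht
        · linear_combination f g 1 0 * ht
        · linear_combination f g 1 1 * ht - d g
      have : ExpChar (Matrix (Fin 2) (Fin 2) k) p := by
        have : CharP (Matrix (Fin 2) (Fin 2) k) p := inferInstance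
        exact ExpChar.prime (Fact.out)
      have h2 : (f g - 1) ^ p ^ 1 = 0 := by
        rw [pow_one]
        exact pow_eq_zero_of_le (Fact.out : p.Prime).two_le h1
      rw [sub_pow_expChar_pow_of_commute _ _ (Commute.one_right _), one_pow, sub_eq_zero] at h2
      rw [map_pow, h2, map_one]
  have hQp : IsPGroup p Q := by
    intro g
    obtain ⟨n, hn⟩ := (trp g).2 (by rw [g.2.2.1, g.2.2.2]; norm_num)
    exact ⟨n, Subtype.ext hn⟩
  have hmemconj : ∀ x, x ≠ 1 → f x 0 0 + f x 1 1 = 2 → x ∈ Q.conjSet := by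
    intro x hx ht
    obtain ⟨P, hP⟩ := hQp.exists_le_sylow
    -- A nontrivial central element `z` of `P` commutes with `u`, so `z ∈ Q`; all of `P` commutes
    -- with `z`, so `P ≤ Q`. Every element of trace `2` is then conjugate into `Q` by Sylow.
    have hPQ : (P : Subgroup H) ≤ Q := by
      have : Nontrivial (P : Subgroup H) :=
        ⟨⟨u, hP huQ⟩, 1, fun h => hu1 (congrArg Subtype.val h)⟩
      have := P.isPGroup'.center_nontrivial
      obtain ⟨z, hz⟩ := exists_ne (1 : Subgroup.center (P : Subgroup H))
      have hzc : ∀ a (ha : a ∈ (P : Subgroup H)), a * (z : P) = (z : P) * a := fun a ha =>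
        congrArg Subtype.val (Subgroup.mem_center_iff.1 z.2 ⟨a, ha⟩)
      have hzQ : ((z : P) : H) ∈ Q := hcent u huQ hu1 _ (hzc u (hP huQ)).symm
      intro a ha
      exact hcent _ hzQ (fun h => hz (Subtype.ext (Subtype.ext h))) a (hzc a ha)
    have hZ : IsPGroup p (Subgroup.zpowers x) := by
      rw [IsPGroup.iff_card]
      obtain ⟨n, hn⟩ := (trp x).2 ht
      rw [Nat.card_zpowers]
      obtain ⟨m, -, hm⟩ := (Nat.dvd_prime_pow (Fact.out : p.Prime)).1 (orderOf_dvd_of_pow_eq_one hn)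
      exact ⟨m, hm⟩
    obtain ⟨P', hP'⟩ := hZ.exists_le_sylow
    obtain ⟨g, rfl⟩ := MulAction.exists_smul_eq H P P'
    have hxg := hP' (Subgroup.mem_zpowers x)
    rw [SetLike.mem_coe.symm] at hxg
    obtain ⟨c, hc, hcx⟩ := hxg
    have hcx : x = g * c * g⁻¹ := by rw [← hcx]; simp [MulAut.conj_apply]
    refine ⟨g, c, hPQ hc, ?_, hcx⟩
    rintro rfl
    simp at hcx
    exact hx hcx
  have hmem : ∀ x ∈ N, x ∈ Q.conjSet → x ∈ Q := by
    rintro x hx ⟨a, c, hc, -, rfl⟩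
    have ht := trconj a c
    rw [hc.2.1, hc.2.2] at ht
    have hd := d (a * c * a⁻¹)
    rw [memN.1 hx] at hd
    have h1 : f (a * c * a⁻¹) 0 0 = 1 := by
      have : (f (a * c * a⁻¹) 0 0 - 1) ^ 2 = 0 := by
        linear_combination f (a * c * a⁻¹) 0 0 * ht - hd
      exact sub_eq_zero.1 (pow_eq_zero_iff two_ne_zero |>.1 this)
    exact ⟨hx, h1, by linear_combination ht - h1⟩
  have top : N = ⊤ := by
    refine Subgroup.eq_top_of_partition Q N hQ (fun g hg => hg.1) ?_ ?_ ?_ ?_ hcent hmem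
    · intro x hx hxU g y hyx hy1 hgyx
      have hX := mt (trtwo x) hx
      have hY := mt (trtwo y) hy1
      obtain ⟨a, b, hab⟩ := Matrix.exists_eq_add_smul_of_commute hX
        (by rw [← map_mul, ← map_mul, hyx] : f y * f x = f x * f y)
      obtain ⟨a', b', hab'⟩ := Matrix.exists_eq_add_smul_of_commute hY
        (by rw [← map_mul, ← map_mul, hyx] : f x * f y = f y * f x)
      -- `y` is a linear polynomial in `x`, so whatever commutes with `x` commutes with `y`. Hence
      -- the conjugate of `y` has the form `r + s * y`.
      have hzy : f (g * y * g⁻¹) * f y = f y * f (g * y * g⁻¹) := by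
        rw [hab, mul_add, add_mul, mul_smul_comm, mul_smul_comm, smul_mul_assoc, smul_mul_assoc,
          ← map_mul, ← map_mul, hgyx]
        simp
      obtain ⟨r, s, hrs⟩ := Matrix.exists_eq_add_smul_of_commute hY hzy
      have hxt : f x 0 0 + f x 1 1 ≠ 2 := fun h => hxU (hmemconj x hx h)
      have hyt : f y 0 0 + f y 1 1 ≠ 2 := by
        intro hyt
        have hyU := hmemconj y hy1 hyt
        obtain ⟨a, c, hc, hc1, rfl⟩ := hyU
        have h1 : a⁻¹ * x * a ∈ Q := by
          refine hcent c hc hc1 _ ?_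
          rw [show a⁻¹ * x * a * c = a⁻¹ * (x * (a * c * a⁻¹)) * a by group, ← hyx]
          group
        apply hxt
        have := trconj a⁻¹ x
        rw [inv_inv, h1.2.1, h1.2.2] at this
        linear_combination -this
      have hyn := trneg y
      have z00 : f (g * y * g⁻¹) 0 0 = r + s * f y 0 0 := by rw [hrs]; simp
      have z01 : f (g * y * g⁻¹) 0 1 = s * f y 0 1 := by rw [hrs]; simp
      have z10 : f (g * y * g⁻¹) 1 0 = s * f y 1 0 := by rw [hrs]; simp
      have z11 : f (g * y * g⁻¹) 1 1 = r + s * f y 1 1 := by rw [hrs]; simp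
      have ht := trconj g y
      have hd := d (g * y * g⁻¹)
      have hd' := d y
      rw [z00, z11] at ht
      rw [z00, z11, z01, z10] at hd
      set t := f y 0 0 + f y 1 1 with htdef
      have ht2 : 2 * r = t * (1 - s) := by rw [htdef]; linear_combination ht
      have hd2 : r * r + r * s * t + s * s = 1 := by
        rw [htdef]; linear_combination hd - s * s * hd'
      -- Conjugation preserves trace and determinant; eliminating `r` from the two equations leaves
      -- this product. If `s = 1`, then `g` commutes with `y`, hence with `x`. If `s = -1`, the
      -- conjugate is `t - y = y⁻¹`, impossible in odd order. The traces `±2` are already excluded.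
      have key : (1 - s) * ((1 + s) * ((t - 2) * (t + 2))) = 0 := by
        linear_combination 4 * hd2 - (2 * r + t * (1 - s) + 2 * s * t) * ht2
      rcases mul_eq_zero.1 key with h1 | h1
      · have hs : s = 1 := by linear_combination -h1
        have hr : r = 0 := by
          rw [hs] at ht2
          simpa [two] using ht2
        have hgy : g * y * g⁻¹ = y := feq _ _ (by rw [z00, hs, hr]; ring)
          (by rw [z01, hs]; ring) (by rw [z10, hs]; ring) (by rw [z11, hs, hr]; ring)
        have hgy' : g * y = y * g := mul_inv_eq_iff_eq_mul.1 hgy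
        apply hf
        rw [map_mul, map_mul, hab', mul_add, add_mul, mul_smul_comm, mul_smul_comm,
          smul_mul_assoc, smul_mul_assoc, ← map_mul, ← map_mul, hgy']
        simp
      · rcases mul_eq_zero.1 h1 with h1 | h1
        · have hs : s = -1 := by linear_combination h1
          have hr : r = t := by
            rw [hs] at ht2
            have : 2 * (r - t) = 0 := by linear_combination ht2
            exact sub_eq_zero.1 ((mul_eq_zero.1 this).resolve_left two)
          refine absurd (eq_one_of_conj_eq_inv hodd (g := g) (y := y) ?_) hy1
          refine feq _ _ ?_ ?_ ?_ ?_
          · rw [z00, hs, hr, htdef, i00]; ring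
          · rw [z01, hs, i01]; ring
          · rw [z10, hs, i10]; ring
          · rw [z11, hs, hr, htdef, i11]; ring
        · exfalso
          rcases mul_eq_zero.1 h1 with h1 | h1
          · exact hyt (by linear_combination h1)
          · exact hyn (by linear_combination h1)
    · intro g y hy hy1 hg
      have hb := Q01 hy hy1
      have e := Matrix.entry_eq_of_mul_eq (by rw [← map_mul, ← map_mul]; simp :
        f (g * y * g⁻¹) * f g = f g * f y) 1 1
      rw [hg.1, hg.2.2, hy.2.2] at e
      exact (mul_eq_zero.1 (by linear_combination -e : f g 1 0 * f y 0 1 = 0)).resolve_right hb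
    · intro n hn c hc
      have hn : f n 1 0 = 0 := hn
      have hd := d n
      obtain ⟨h1, h2, h3⟩ := hc
      refine memQ.2 ⟨?_, ?_, ?_⟩ <;> simp only [fm, i00, i01, i10, i11, hn, h1, h2, h3] <;>
        rw [hn] at hd
      · ring
      · linear_combination hd
      · linear_combination hd
    · intro a ha b hb
      have ha : f a 1 0 = 0 := ha
      have hb : f b 1 0 = 0 := hb
      have hda := d a
      have hdb := d b
      rw [ha] at hda
      rw [hb] at hdb
      refine memQ.2 ⟨?_, ?_, ?_⟩ <;> simp only [fm, i00, i01, i10, i11, ha, hb]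
      · ring
      · linear_combination (f b 0 0 * f b 1 1) * hda + hdb
      · linear_combination (f b 0 0 * f b 1 1) * hda + hdb
  have : g ∈ N := top ▸ Subgroup.mem_top g
  exact this

end TwoByTwo

/-! ### Vanishing of `H¹` for faithful planes. -/

section Vanishing

variable {k : Type*} [Field k]

/-- If every cocycle is a coboundary, then `H¹` vanishes. -/
lemma subsingleton_H1_of_forall {Γ V : Type u} {k : Type u} [Field k] [Group Γ] [AddCommGroup V]
    [Module k V] (ρ : Representation k Γ V)
    (h : ∀ z : Γ → V, (∀ g h, z (g * h) = ρ g (z h) + z g) → ∃ v, ∀ g, ρ g v - v = z g) :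
    Subsingleton (groupCohomology.H1 (Rep.of ρ)) := by
  refine subsingleton_of_forall_eq 0 fun x => ?_
  induction x using groupCohomology.H1_induction_on with
  | h z =>
    rw [groupCohomology.H1π_eq_zero_iff]
    obtain ⟨v, hv⟩ := h z ((groupCohomology.mem_cocycles₁_iff z.1).1 z.2)
    exact ⟨v, funext hv⟩

/-- A group of order prime to the characteristic has trivial `H¹`. -/
lemma exists_coboundary_of_card_ne_zero {Γ V : Type*} [Group Γ] [Finite Γ] [AddCommGroup V]
    [Module k V] (ρ : Representation k Γ V) (hΓ : (Nat.card Γ : k) ≠ 0) (z : Γ → V)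
    (hz : ∀ g h, z (g * h) = ρ g (z h) + z g) : ∃ v, ∀ g, ρ g v - v = z g := by
  have := Fintype.ofFinite Γ
  refine ⟨-(Nat.card Γ : k)⁻¹ • ∑ h, z h, fun g => ?_⟩
  have h1 : ∑ h, z h = ρ g (∑ h, z h) + (Nat.card Γ : k) • z g := by
    rw [map_sum]
    conv_lhs => rw [← Equiv.sum_comp (Equiv.mulLeft g) z]
    simp only [Equiv.coe_mulLeft, hz, Finset.sum_add_distrib, Finset.sum_const, Finset.card_univ,
      Nat.card_eq_fintype_card, Nat.cast_smul_eq_nsmul]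
  have h2 : ρ g (∑ h, z h) = ∑ h, z h - (Nat.card Γ : k) • z g := by rw [eq_sub_iff_add_eq, ← h1]
  rw [map_smul, h2, smul_sub, smul_smul, neg_mul, inv_mul_cancel₀ hΓ]
  simp

/-- A group that contains a central element acting as `-1` has trivial `H¹`. -/
lemma exists_coboundary_of_neg_one {Γ V : Type*} [Group Γ] [AddCommGroup V]
    [Module k V] (ρ : Representation k Γ V) (h2 : (2 : k) ≠ 0) (c : Γ) (hc : ∀ g, c * g = g * c)
    (hρ : ∀ v, ρ c v = -v) (z : Γ → V)
    (hz : ∀ g h, z (g * h) = ρ g (z h) + z g) : ∃ v, ∀ g, ρ g v - v = z g := by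
  refine ⟨-(2 : k)⁻¹ • z c, fun g => ?_⟩
  -- Expanding `z (c * g) = z (g * c)` both ways gives `ρ g (z c) - z c = -2 * z g`.
  have h1 := hz c g
  rw [hc, hz, hρ] at h1
  have h3 : ρ g (z c) - z c = -(2 : k) • z g := by
    rw [sub_eq_iff_eq_add, eq_sub_of_add_eq h1, neg_smul, two_smul]
    abel
  rw [map_smul, ← smul_sub, h3, smul_smul]
  simp [h2]

/-- A finite group acting faithfully on a plane over a field of odd characteristic, with an element
`u` whose order is the characteristic, either contains `-1` or stabilizes exactly one line. -/
theorem exists_neg_one_or_existsUnique_line (p : ℕ) [Fact p.Prime] [CharP k p] (hp : p ≠ 2)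
    {Γ V : Type*} [Group Γ] [Finite Γ] [AddCommGroup V] [Module k V] (ρ : Representation k Γ V)
    (hV : Module.finrank k V = 2) (hρ : Function.Injective ρ) (hpΓ : p ∣ Nat.card Γ) :
    (∃ c, ρ c = -1) ∨
      ∃! l : Submodule k V, Module.finrank k l = 1 ∧ ∀ g, ∀ v ∈ l, ρ g v ∈ l := by
  have pprime : p.Prime := Fact.out
  have : Nontrivial V := Module.nontrivial_of_finrank_pos (R := k) (by omega)
  have : FiniteDimensional k V := Module.finite_of_finrank_pos (by omega)
  obtain ⟨u, hu⟩ := exists_prime_orderOf_dvd_card' p hpΓ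
  have hup : u ^ p = 1 := hu ▸ pow_orderOf_eq_one u
  have hu1 : u ≠ 1 := fun h => pprime.one_lt.ne' (by rw [← hu, h, orderOf_one])
  obtain ⟨v, hv0, hv⟩ : ∃ v, v ≠ 0 ∧ ρ u v = v := by
    -- In characteristic `p` this power is `ρ (u ^ p) - 1`; a nilpotent map on a nonzero space has a
    -- nonzero kernel.
    have hnil : (ρ u - 1) ^ p = 0 := by
      have : CharP (Module.End k V) p := charP_of_injective_algebraMap
        (FaithfulSMul.algebraMap_injective k (Module.End k V)) p
      rw [sub_pow_char_of_commute _ (Commute.one_right _), ← map_pow, hup]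
      simp
    by_contra! hne
    have hinj : Function.Injective ⇑(ρ u - 1) := by
      rw [injective_iff_map_eq_zero]
      intro v hv
      by_contra hv0
      exact hne v hv0 (sub_eq_zero.1 hv)
    obtain ⟨w, hw⟩ := exists_ne (0 : V)
    have : Function.Injective ⇑((ρ u - 1) ^ p) := by
      rw [Module.End.coe_pow]
      exact hinj.iterate p
    rw [hnil] at this
    exact hw (this rfl)
  obtain ⟨w, hw⟩ : ∃ w, w ∉ Submodule.span k {v} := by
    by_contra! h
    have h1 : Submodule.span k {v} = ⊤ := Submodule.eq_top_iff'.2 h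
    have h2 := finrank_span_singleton (K := k) hv0
    rw [h1, finrank_top] at h2
    omega
  have hli : LinearIndependent k ![v, w] := by
    rw [LinearIndependent.pair_iff' hv0]
    intro a ha
    exact hw (Submodule.mem_span_singleton.2 ⟨a, ha⟩)
  let b := basisOfLinearIndependentOfCardEqFinrank hli (by simp [hV])
  have b0 : b 0 = v := by simp [b]
  have b1 : b 1 = w := by simp [b]
  let f : Γ →* Matrix (Fin 2) (Fin 2) k :=
    (LinearMap.toMatrixAlgEquiv b : _ →* Matrix (Fin 2) (Fin 2) k).comp ρ
  have hf : Function.Injective f := (LinearMap.toMatrixAlgEquiv b).injective.comp hρ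
  have fapp : ∀ g i j, f g i j = b.repr (ρ g (b j)) i := fun g i j =>
    LinearMap.toMatrixAlgEquiv_apply b _ i j
  have ρb : ∀ g j, ρ g (b j) = f g 0 j • b 0 + f g 1 j • b 1 := fun g j => by
    rw [fapp, fapp]
    exact (Fin.sum_univ_two (fun i => b.repr (ρ g (b j)) i • b i)) ▸ (b.sum_repr _).symm
  have u00 : f u 0 0 = 1 := by rw [fapp, b0, hv, ← b0]; simp
  have u10 : f u 1 0 = 0 := by rw [fapp, b0, hv, ← b0]; simp
  have u11 : f u 1 1 = 1 := by
    have h1 : (f u).det ^ p = 1 := by rw [← Matrix.det_pow, ← map_pow, hup]; simp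
    rw [Matrix.det_fin_two, u00, u10] at h1
    simp only [one_mul, mul_zero, sub_zero] at h1
    have h2 : (f u 1 1 - 1) ^ p = 0 := by rw [sub_pow_char, h1]; simp
    exact sub_eq_zero.1 (pow_eq_zero_iff pprime.ne_zero |>.1 h2)
  have u01 : f u 0 1 ≠ 0 := fun h => hu1 <| hf <| by
    ext i j; fin_cases i <;> fin_cases j <;> simp [u00, u10, u11, h]
  let H : Subgroup Γ := (Matrix.detMonoidHom.comp f).ker
  have memH : ∀ {g}, g ∈ H ↔ (f g).det = 1 := Iff.rfl
  have uH : u ∈ H := by rw [memH, Matrix.det_fin_two, u00, u10, u11]; simp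
  rcases Nat.even_or_odd (Nat.card H) with heven | hodd
  · left
    obtain ⟨⟨c, hcH⟩, hc⟩ := exists_prime_orderOf_dvd_card' (G := H) 2 heven.two_dvd
    have hc2 : c ^ 2 = 1 := congrArg Subtype.val (hc ▸ pow_orderOf_eq_one (⟨c, hcH⟩ : H))
    have hc1 : f c ≠ 1 := fun h => by
      have h1 : c = 1 := hf (by rw [h, map_one])
      subst h1
      have : (⟨1, hcH⟩ : H) = 1 := rfl
      rw [this, orderOf_one] at hc
      omega
    have two : (2 : k) ≠ 0 := Ring.two_ne_zero (by rwa [ringChar.eq k p])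
    rw [memH, Matrix.det_fin_two] at hcH
    have e : f c * f c = 1 * 1 := by rw [← map_mul, ← pow_two, hc2]; simp
    have e00 := Matrix.entry_eq_of_mul_eq e 0 0
    have e01 := Matrix.entry_eq_of_mul_eq e 0 1
    have e10 := Matrix.entry_eq_of_mul_eq e 1 0
    have e11 := Matrix.entry_eq_of_mul_eq e 1 1
    simp only [Matrix.one_apply_eq, Matrix.one_apply_ne zero_ne_one,
      Matrix.one_apply_ne one_ne_zero] at e00 e01 e10 e11
    set t := f c 0 0 + f c 1 1 with ht
    -- Cayley–Hamilton for an involution of determinant `1` reads `t * c = c² + 1 = 2`, so `c` is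
    -- scalar, hence `-1`.
    have t0 : t * f c 0 0 = 2 := by rw [ht]; linear_combination e00 + hcH
    have t1 : t * f c 1 1 = 2 := by rw [ht]; linear_combination e11 + hcH
    have tne : t ≠ 0 := fun h => two (by rw [← t0, h, zero_mul])
    have c01 : f c 0 1 = 0 := (mul_eq_zero.1 (by rw [ht]; linear_combination e01 :
      t * f c 0 1 = 0)).resolve_left tne
    have c10 : f c 1 0 = 0 := (mul_eq_zero.1 (by rw [ht]; linear_combination e10 :
      t * f c 1 0 = 0)).resolve_left tne
    have had : f c 0 0 = f c 1 1 := mul_left_cancel₀ tne (t0.trans t1.symm)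
    have hne : f c 0 0 ≠ 1 := fun h => hc1 <| by
      ext i j; fin_cases i <;> fin_cases j <;> simp [c01, c10, h, ← had]
    have hneg : f c 0 0 = -1 := by
      rw [c10] at e00
      have : (f c 0 0 - 1) * (f c 0 0 + 1) = 0 := by linear_combination e00
      exact eq_neg_of_add_eq_zero_left
        ((mul_eq_zero.1 this).resolve_left (sub_ne_zero.2 hne))
    refine ⟨c, b.ext fun i => ?_⟩
    fin_cases i
    · simp [ρb, c10, hneg]
    · simp [ρb, c01, ← had, hneg]
  · right
    have hH : ∀ g ∈ H, f g 1 0 = 0 := fun g hg =>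
      upperTriangular_of_odd p hp hodd (f.comp H.subtype) (hf.comp Subtype.val_injective)
        (fun g => g.2) ⟨u, uH⟩ (fun h => hu1 (congrArg Subtype.val h)) u00 u10 u11 ⟨g, hg⟩
    have hΓ : ∀ g, f g 1 0 = 0 := by
      intro g
      -- The conjugate lies in the normal subgroup `H`, so it is triangular. Comparing bottom rows
      -- in `(g * u * g⁻¹) * g = g * u` then rules out a nonzero lower-left entry of `g`.
      have hM : f (g * u * g⁻¹) 1 0 = 0 := by
        apply hH
        have : H.Normal := MonoidHom.normal_ker _
        exact this.conj_mem u uH g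
      have e := Matrix.entry_eq_of_mul_eq (by rw [← map_mul, ← map_mul]; simp :
        f (g * u * g⁻¹) * f g = f g * f u)
      have e10 := e 1 0
      have e11 := e 1 1
      rw [hM, u00, u10] at e10
      rw [hM, u11] at e11
      by_contra h
      have hM1 : f (g * u * g⁻¹) 1 1 = 1 := mul_right_cancel₀ h (by linear_combination e10)
      rw [hM1] at e11
      exact mul_ne_zero h u01 (by linear_combination -e11)
    refine ⟨Submodule.span k {v}, ⟨finrank_span_singleton hv0, ?_⟩, ?_⟩
    · intro g x hx
      obtain ⟨a, rfl⟩ := Submodule.mem_span_singleton.1 hx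
      refine Submodule.mem_span_singleton.2 ⟨a * f g 0 0, ?_⟩
      have := ρb g 0
      rw [hΓ, zero_smul, add_zero, b0] at this
      rw [map_smul, this, smul_smul]
    · rintro l ⟨hl1, hl⟩
      have hvl : v ∈ l := by
        obtain ⟨⟨x, hxl⟩, hx0, -⟩ := finrank_eq_one_iff'.1 hl1
        have hx0 : x ≠ 0 := fun h => hx0 (Subtype.ext h)
        have hx : x = b.repr x 0 • b 0 + b.repr x 1 • b 1 :=
          (Fin.sum_univ_two (fun i => b.repr x i • b i)) ▸ (b.sum_repr _).symm
        by_cases h1 : b.repr x 1 = 0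
        · rw [h1, zero_smul, add_zero] at hx
          have h0 : b.repr x 0 ≠ 0 := fun h => hx0 (by rw [hx, h, zero_smul])
          rw [hx, b0] at hxl
          exact (l.smul_mem_iff h0).1 hxl
        -- A stable line not spanned by `v` would still contain this nonzero multiple of `v`.
        · have hux : ρ u x - x = (b.repr x 1 * f u 0 1) • v := by
            conv_lhs => rw [hx]
            rw [map_add, map_smul, map_smul, ρb, ρb, u00, u10, u11, b0, b1]
            module
          exact (l.smul_mem_iff (mul_ne_zero h1 u01)).1 (hux ▸ l.sub_mem (hl u x hxl) hxl)
      have : FiniteDimensional k l := Module.finite_of_finrank_pos (by omega)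
      refine (Submodule.eq_of_le_of_finrank_eq
        ((Submodule.span_singleton_le_iff_mem v l).2 hvl) ?_).symm
      rw [finrank_span_singleton hv0, hl1]

/-- A faithful two-dimensional representation over a finite field of odd characteristic that does
not stabilize exactly one line has trivial `H¹`. -/
theorem subsingleton_H1_of_not_existsUnique_line {k Γ V : Type u} [Field k] [Finite k] [Group Γ]
    [AddCommGroup V] [Module k V] (hk : 3 ≤ ringChar k) (ρ : Representation k Γ V)
    (hV : Module.finrank k V = 2) (hρ : Function.Injective ρ)
    (hl : ¬ ∃! l : Submodule k V, Module.finrank k l = 1 ∧ ∀ g, ∀ v ∈ l, ρ g v ∈ l) :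
    Subsingleton (groupCohomology.H1 (Rep.of ρ)) := by
  have : FiniteDimensional k V := Module.finite_of_finrank_pos (by omega)
  have : Finite V := Module.finite_of_finite k
  have : Finite (Module.End k V) := Finite.of_injective _ DFunLike.coe_injective
  have : Finite Γ := Finite.of_injective _ hρ
  have : Fact (ringChar k).Prime := ⟨CharP.char_is_prime k _⟩
  refine subsingleton_H1_of_forall ρ fun z hz => ?_
  by_cases hΓ : (Nat.card Γ : k) = 0
  · rcases exists_neg_one_or_existsUnique_line (ringChar k) (by omega) ρ hV hρ
      ((CharP.cast_eq_zero_iff k _ _).1 hΓ) with ⟨c, hc⟩ | h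
    · refine exists_coboundary_of_neg_one ρ (Ring.two_ne_zero (by omega)) c ?_ ?_ z hz
      · intro g
        apply hρ
        rw [map_mul, map_mul, hc, neg_one_mul, mul_neg_one]
      · intro v
        rw [hc]
        rfl
    · exact absurd h hl
  · exact exists_coboundary_of_card_ne_zero ρ hΓ z hz

lemma standardRep_apply {F : Type u} [Field F] (G : Subgroup (GL (Fin 2) F)) (g : G)
    (v : Fin 2 → F) : standardRep G g v = ((g : GL (Fin 2) F) : Matrix _ _ F).mulVec v := rfl

theorem subsingleton_H1_standardRep (F : Type u) [Field F] [Finite F] (hF : 3 ≤ ringChar F)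
    (G : Subgroup (GL (Fin 2) F)) (hG : ¬ ∃! l : Submodule F (Fin 2 → F), FixesLine G l) :
    Subsingleton (groupCohomology.H1 (Rep.of (standardRep G))) := by
  refine subsingleton_H1_of_not_existsUnique_line hF _ (by simp) ?_ ?_
  · intro g h hgh
    refine Subtype.ext (Units.ext ?_)
    exact (Matrix.toLinAlgEquiv' (R := F) (n := Fin 2)).injective hgh
  · convert hG using 4
    simp [FixesLine, standardRep_apply]

end Vanishing

/-! ### Field-valued points of schemes and their fields of definition. -/

/-- The image of the residue field under a field-valued point of a scheme. -/
noncomputable def AlgebraicGeometry.Scheme.pointRange {X : Scheme.{u}} {L : Type u} [Field L]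
    (p : Spec (.of L) ⟶ X) : Set L :=
  Set.range (Scheme.SpecToEquivOfField L X p).2.hom

lemma AlgebraicGeometry.Scheme.SpecToEquivOfField_map_comp {X : Scheme.{u}} {L M : Type u}
    [Field L] [Field M] (i : CommRingCat.of L ⟶ CommRingCat.of M) (q : Spec (.of L) ⟶ X) :
    Scheme.SpecToEquivOfField M X (Spec.map i ≫ q) =
      ⟨(Scheme.SpecToEquivOfField L X q).1, (Scheme.SpecToEquivOfField L X q).2 ≫ i⟩ := by
  rw [← Equiv.eq_symm_apply]
  conv_lhs => rw [← (Scheme.SpecToEquivOfField L X).symm_apply_apply q]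
  simp only [Scheme.SpecToEquivOfField_symm_apply, Spec.map_comp, Category.assoc]

lemma AlgebraicGeometry.Scheme.pointRange_map_comp {X : Scheme.{u}} {L M : Type u}
    [Field L] [Field M] (i : CommRingCat.of L ⟶ CommRingCat.of M) (q : Spec (.of L) ⟶ X) :
    Scheme.pointRange (Spec.map i ≫ q) = i.hom '' Scheme.pointRange q := by
  unfold Scheme.pointRange
  rw [Scheme.SpecToEquivOfField_map_comp, CommRingCat.hom_comp, RingHom.coe_comp, Set.range_comp]

/-- Descent of a point: the map from the residue field to `M` lands in the image of `L`, hence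
factors through `L`. -/
lemma AlgebraicGeometry.Scheme.exists_map_comp_eq {X : Scheme.{u}} {L M : Type u}
    [Field L] [Field M] (i : CommRingCat.of L ⟶ CommRingCat.of M) (p : Spec (.of M) ⟶ X)
    (h : Scheme.pointRange p ⊆ Set.range i.hom) : ∃ q : Spec (.of L) ⟶ X, Spec.map i ≫ q = p := by
  obtain ⟨⟨x, φ⟩, rfl⟩ := (Scheme.SpecToEquivOfField M X).symm.surjective p
  have h : ∀ a, φ.hom a ∈ i.hom.range := fun a => by
    have := @h (φ.hom a)
    unfold Scheme.pointRange at this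
    rw [Equiv.apply_symm_apply] at this
    exact this ⟨a, rfl⟩
  let ψ : X.residueField x →+* L :=
    ((RingEquiv.ofLeftInverse (f := i.hom)
      (Function.leftInverse_invFun i.hom.injective)).symm : i.hom.range →+* L).comp
      (φ.hom.codRestrict i.hom.range h)
  have hψ : CommRingCat.ofHom ψ ≫ i = φ := by
    ext a
    have := (RingEquiv.ofLeftInverse (f := i.hom)
      (Function.leftInverse_invFun i.hom.injective)).apply_symm_apply
        (φ.hom.codRestrict i.hom.range h a)
    exact congrArg Subtype.val this
  refine ⟨Spec.map (CommRingCat.ofHom ψ) ≫ X.fromSpecResidueField x, ?_⟩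
  rw [Scheme.SpecToEquivOfField_symm_apply, ← hψ, Spec.map_comp, Category.assoc]

lemma AlgebraicGeometry.Scheme.SpecMap_comp_injective {X : Scheme.{u}} {L M : Type u}
    [Field L] [Field M] (i : CommRingCat.of L ⟶ CommRingCat.of M) {q r : Spec (.of L) ⟶ X}
    (h : Spec.map i ≫ q = Spec.map i ≫ r) : q = r := by
  apply (Scheme.SpecToEquivOfField L X).injective
  have := congrArg (Scheme.SpecToEquivOfField M X) h
  rw [Scheme.SpecToEquivOfField_map_comp, Scheme.SpecToEquivOfField_map_comp] at this
  generalize Scheme.SpecToEquivOfField L X q = a at *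
  generalize Scheme.SpecToEquivOfField L X r = b at *
  obtain ⟨a, φ⟩ := a
  obtain ⟨b, ψ⟩ := b
  obtain ⟨rfl, h2⟩ := Sigma.mk.inj_iff.1 this
  have h2 := eq_of_heq h2
  congr 1
  ext t
  exact i.hom.injective (congrArg (fun f => f.hom t) h2)

/-- Invariance of `q` says that composing its residue field map with `i` changes nothing. -/
lemma AlgebraicGeometry.Scheme.apply_eq_of_mem_pointRange {X : Scheme.{u}} {L : Type u}
    [Field L] (i : CommRingCat.of L ⟶ CommRingCat.of L) (q : Spec (.of L) ⟶ X)
    (h : Spec.map i ≫ q = q) {a : L} (ha : a ∈ Scheme.pointRange q) : i.hom a = a := by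
  have := congrArg (Scheme.SpecToEquivOfField L X) h
  rw [Scheme.SpecToEquivOfField_map_comp] at this
  unfold Scheme.pointRange at ha
  generalize Scheme.SpecToEquivOfField L X q = b at *
  obtain ⟨b, φ⟩ := b
  have h2 := eq_of_heq (Sigma.mk.inj_iff.1 this).2
  obtain ⟨t, rfl⟩ := ha
  exact congrArg (fun f => f.hom t) h2

/-! ### Galois action on torsion points and the field `F(A[I])`. -/

namespace AbVar

namespace Point

variable {K : Type u} [Field K] {A : AbVar K}
variable {L M : Type u} [Field L] [Algebra K L] [Field M] [Algebra K M]

/-- The image in `L` of the residue field at an `L`-rational point. -/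
noncomputable def coeffs (x : A.Point L) : Set L :=
  Scheme.pointRange (show specOver K L ⟶ A.X from x).left

lemma coeffs_map (φ : L →ₐ[K] M) (x : A.Point L) : (map φ x).coeffs = φ '' x.coeffs :=
  Scheme.pointRange_map_comp (CommRingCat.ofHom φ.toRingHom) _

lemma map_injective (φ : L →ₐ[K] M) : Function.Injective (map (A := A) φ) := by
  intro x y h
  refine Over.OverMorphism.ext ?_
  exact Scheme.SpecMap_comp_injective (CommRingCat.ofHom φ.toRingHom)
    (congrArg (fun f : specOver K M ⟶ A.X => f.left) h)

lemma exists_map_eq_iff (φ : L →ₐ[K] M) (x : A.Point M) :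
    (∃ y : A.Point L, map φ y = x) ↔ x.coeffs ⊆ Set.range φ := by
  constructor
  · rintro ⟨y, rfl⟩
    rw [coeffs_map]
    exact Set.image_subset_range _ _
  · intro h
    obtain ⟨q, hq⟩ := Scheme.exists_map_comp_eq (CommRingCat.ofHom φ.toRingHom)
      (show specOver K M ⟶ A.X from x).left h
    have hw : q ≫ A.X.hom = (specOver K L).hom := by
      refine Scheme.SpecMap_comp_injective (CommRingCat.ofHom φ.toRingHom) ?_
      rw [← Category.assoc, hq]
      exact (Over.w (show specOver K M ⟶ A.X from x)).trans (Over.w (specOverMap φ)).symm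
    exact ⟨(Over.homMk q hw : specOver K L ⟶ A.X), Over.OverMorphism.ext hq⟩

lemma apply_eq_of_mem_coeffs (φ : L →ₐ[K] L) (x : A.Point L) (h : map φ x = x) {a : L}
    (ha : a ∈ x.coeffs) : φ a = a :=
  Scheme.apply_eq_of_mem_pointRange (CommRingCat.ofHom φ.toRingHom) _
    (congrArg (fun f : specOver K L ⟶ A.X => f.left) h) ha

end Point

section

variable {K : Type u} [Field K] {A : AbVar K} {O : Type u} [CommRing O] (e : O ≃+* A.EndK)
  (I : Ideal O) (F : IntermediateField K (AlgebraicClosure K))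

/-- The `O`-linear map `A(L) → A(M)` induced by a `K`-embedding `φ : L → M`. -/
noncomputable def PointVia.map {L M : Type u} [Field L] [Algebra K L] [Field M] [Algebra K M]
    (φ : L →ₐ[K] M) : PointVia e L →ₗ[O] PointVia e M where
  toFun x := Point.map (A := A) φ x
  map_add' x y := (Point.map (A := A) φ).map_add x y
  map_smul' a x := (Point.map (A := A) φ).map_smul (e a) x

/-- The image in `L` of the residue field at an `L`-rational point. -/
noncomputable def PointVia.coeffs {L : Type u} [Field L] [Algebra K L] (x : PointVia e L) :
    Set L :=
  Point.coeffs (A := A) x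

lemma PointVia.coeffs_map {L M : Type u} [Field L] [Algebra K L] [Field M] [Algebra K M]
    (φ : L →ₐ[K] M) (x : PointVia e L) :
    PointVia.coeffs e (PointVia.map e φ x) = φ '' PointVia.coeffs e x :=
  Point.coeffs_map φ x

lemma PointVia.map_injective {L M : Type u} [Field L] [Algebra K L] [Field M] [Algebra K M]
    (φ : L →ₐ[K] M) : Function.Injective (PointVia.map e φ) :=
  Point.map_injective (A := A) φ

lemma torsionField_le {L : IntermediateField K (AlgebraicClosure K)} (hF : F ≤ L)
    (h : ∀ x ∈ torsion e I (AlgebraicClosure K),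
      PointVia.coeffs e x ⊆ (L : Set (AlgebraicClosure K))) : torsionField e I F ≤ L := by
  refine sInf_le ⟨hF, fun x hx => ?_⟩
  refine (Point.exists_map_eq_iff L.val x).2 ?_
  exact (h x hx).trans (Subtype.range_val (s := (L : Set (AlgebraicClosure K)))).ge

/-- Being defined over `L` amounts to an inclusion of `coeffs` in `L`, a condition stable under
intersection. So the infimum defining `F(A[I])` is itself a field over which all torsion points are
defined. -/
lemma coeffs_subset_torsionField {x : PointVia e (AlgebraicClosure K)}
    (hx : x ∈ torsion e I (AlgebraicClosure K)) :
    PointVia.coeffs e x ⊆ (torsionField e I F : Set (AlgebraicClosure K)) := by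
  rw [torsionField, IntermediateField.coe_sInf]
  refine Set.subset_iInter₂ fun L hL => ?_
  exact ((Point.exists_map_eq_iff L.val x).1 (hL.2 x hx)).trans
    (Subtype.range_val (s := (L : Set (AlgebraicClosure K)))).le

/-- The inclusion of `F(A[I])` in the algebraic closure. -/
noncomputable def torsionExtVal : torsionExt e I F →ₐ[K] AlgebraicClosure K :=
  (torsionExt e I F).val.restrictScalars K

lemma range_torsionExtVal :
    Set.range (torsionExtVal e I F) = (torsionField e I F : Set (AlgebraicClosure K)) := by
  ext a
  exact ⟨fun ⟨b, hb⟩ => hb ▸ b.2, fun h => ⟨⟨a, h⟩, rfl⟩⟩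

lemma map_mem_torsion_iff {L M : Type u} [Field L] [Algebra K L] [Field M] [Algebra K M]
    (φ : L →ₐ[K] M) (y : PointVia e L) :
    PointVia.map e φ y ∈ torsion e I M ↔ y ∈ torsion e I L := by
  rw [Submodule.mem_torsionBySet_iff, Submodule.mem_torsionBySet_iff]
  refine forall_congr' fun a => ?_
  rw [← map_smul]
  exact map_eq_zero_iff (PointVia.map e φ) (PointVia.map_injective e φ)

/-- The map on `I`-torsion induced by a `K`-embedding. -/
noncomputable def torsionMap {L M : Type u} [Field L] [Algebra K L] [Field M] [Algebra K M]
    (φ : L →ₐ[K] M) : torsion e I L →ₗ[O ⧸ I] torsion e I M where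
  toFun y := ⟨PointVia.map e φ y.1, (map_mem_torsion_iff e I _ _).2 y.2⟩
  map_add' x y := Subtype.ext ((PointVia.map e φ).map_add x.1 y.1)
  map_smul' a x := by
    obtain ⟨a, rfl⟩ := Ideal.Quotient.mk_surjective a
    exact Subtype.ext ((PointVia.map e φ).map_smul a x.1)

lemma torsionMap_bijective : Function.Bijective (torsionMap e I (torsionExtVal e I F)) := by
  refine ⟨fun x y h => Subtype.ext (PointVia.map_injective e _ (congrArg Subtype.val h)),
    fun x => ?_⟩
  obtain ⟨y, hy⟩ := (Point.exists_map_eq_iff (A := A) (torsionExtVal e I F) x.1).2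
    ((coeffs_subset_torsionField e I F x.2).trans (range_torsionExtVal e I F).ge)
  have hy : PointVia.map e (torsionExtVal e I F) y = x.1 := hy
  exact ⟨⟨y, (map_mem_torsion_iff e I (torsionExtVal e I F) y).1 (hy ▸ x.2)⟩, Subtype.ext hy⟩

/-- All `I`-torsion points are defined over `F(A[I])`. -/
noncomputable def torsionEquiv :
    torsion e I (torsionExt e I F) ≃ₗ[O ⧸ I] torsion e I (AlgebraicClosure K) :=
  LinearEquiv.ofBijective (torsionMap e I (torsionExtVal e I F)) (torsionMap_bijective e I F)

/-- The Galois group of `F(A[I])` over `F` acts faithfully on `A[I]`. -/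
lemma torsionRep_injective : Function.Injective (torsionRep e I (torsionExt e I F) F) := by
  rw [injective_iff_map_eq_one]
  intro σ hσ
  -- If `σ` fixes every torsion point, its fixed field contains all their `coeffs`; by minimality it
  -- is the whole of `F(A[I])`.
  let M : IntermediateField F (AlgebraicClosure K) :=
    (IntermediateField.fixedField (Subgroup.zpowers σ)).map (torsionExt e I F).val
  have hM : torsionField e I F ≤ M.restrictScalars K := by
    refine torsionField_le e I F (fun a ha => M.algebraMap_mem ⟨a, ha⟩) fun x hx => ?_
    obtain ⟨y, hy⟩ := (torsionEquiv e I F).surjective ⟨x, hx⟩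
    have hxy : x = PointVia.map e (torsionExtVal e I F) y.1 :=
      (congrArg Subtype.val hy).symm
    rw [hxy, PointVia.coeffs_map]
    rintro _ ⟨a, ha, rfl⟩
    refine ⟨a, ?_, rfl⟩
    have h1 : Point.map (A := A) (σ.toAlgHom.restrictScalars K) y.1 = y.1 :=
      congrArg Subtype.val (LinearMap.congr_fun hσ y)
    have h2 : σ a = a := Point.apply_eq_of_mem_coeffs _ _ h1 ha
    rintro ⟨τ, hτ⟩
    have : Subgroup.zpowers σ ≤ MulAction.stabilizer _ a := by
      rw [Subgroup.zpowers_le]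
      exact h2
    exact this hτ
  refine AlgEquiv.ext fun a => ?_
  obtain ⟨b, hb, hba⟩ := hM a.2
  have : b = a := Subtype.ext hba
  subst this
  exact hb ⟨σ, Subgroup.mem_zpowers σ⟩

lemma map_mem_torsionField (τ : Gal(AlgebraicClosure K/K)) (hτ : τ ∈ F.fixingSubgroup)
    {a : AlgebraicClosure K} (ha : a ∈ torsionField e I F) : τ a ∈ torsionField e I F := by
  -- `τ` sends torsion points to torsion points, so the `τ⁻¹`-image of `F(A[I])` also contains all
  -- `coeffs`; minimality applies again.
  have h : torsionField e I F ≤ (torsionField e I F).map 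
      (τ⁻¹ : Gal(AlgebraicClosure K/K)).toAlgHom := by
    refine torsionField_le e I F (fun b hb => ⟨b, le_torsionField e I F hb, ?_⟩) fun x hx => ?_
    · exact (IntermediateField.mem_fixingSubgroup_iff _ _).1 (inv_mem hτ) b hb
    · have h1 := coeffs_subset_torsionField e I F
        (galMap_mem_torsion e I (AlgebraicClosure K) τ.toAlgHom x hx)
      have h2 : PointVia.coeffs e (galMap e (AlgebraicClosure K) τ.toAlgHom x) =
        τ '' PointVia.coeffs e x := Point.coeffs_map τ.toAlgHom x
      intro c hc
      refine ⟨τ c, h1 (h2 ▸ ⟨c, hc, rfl⟩), ?_⟩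
      exact τ.symm_apply_apply c
  obtain ⟨b, hb, rfl⟩ := h ha
  have : τ ((τ⁻¹ : Gal(AlgebraicClosure K/K)) b) = b := τ.apply_symm_apply b
  exact (congrArg (· ∈ torsionField e I F) this).mpr hb

/-- The restriction to `F(A[I])` of an automorphism that fixes `F`. -/
noncomputable def restrictTorsionExt (τ : F.fixingSubgroup) : Gal(torsionExt e I F/F) where
  toFun a := ⟨τ.1 a, map_mem_torsionField e I F τ.1 τ.2 a.2⟩
  invFun a := ⟨τ.1⁻¹ a, map_mem_torsionField e I F τ.1⁻¹ (inv_mem τ.2) a.2⟩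
  left_inv a := Subtype.ext (τ.1.symm_apply_apply a)
  right_inv a := Subtype.ext (τ.1.apply_symm_apply a)
  map_mul' _ _ := Subtype.ext (map_mul τ.1 _ _)
  map_add' _ _ := Subtype.ext (map_add τ.1 _ _)
  commutes' a := Subtype.ext ((IntermediateField.mem_fixingSubgroup_iff _ _).1 τ.2 a a.2)

lemma torsionEquiv_torsionRep (τ : F.fixingSubgroup) (y : torsion e I (torsionExt e I F)) :
    torsionEquiv e I F (torsionRep e I (torsionExt e I F) F (restrictTorsionExt e I F τ) y) =
      galRepRestrict e I F τ (torsionEquiv e I F y) := by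
  refine Subtype.ext ?_
  exact (Point.map_comp (A := A) (torsionExtVal e I F)
    ((restrictTorsionExt e I F τ).toAlgHom.restrictScalars K) y.1).symm.trans
    (Point.map_comp (A := A) (τ.1.toAlgHom.restrictScalars K) (torsionExtVal e I F) y.1)

end

/-- A line stable under `Gal(F(A[P])|F)` is carried by `torsionEquiv` to a line stable under the
absolute Galois group of `F`, against irreducibility. This needs only that automorphisms restrict to
`F(A[P])`, not that restriction is surjective. -/
theorem subsingleton_H1_torsionModule {K : Type u} [Field K] {A : AbVar K} {O : Type u}
    [CommRing O] (e : O ≃+* A.EndK) (h : IsGL2Type e) (P : Ideal O) [P.IsMaximal]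
    (hP : IsRegularPrime P) (hp : 3 ≤ ringChar (O ⧸ P))
    (F : IntermediateField K (AlgebraicClosure K)) :
    letI : Field (O ⧸ P) := Ideal.Quotient.field P
    (galRepRestrict e P F).IsIrreducible →
      Subsingleton (groupCohomology.H1 (torsionModule e P F)) := by
  let _ : Field (O ⧸ P) := Ideal.Quotient.field P
  intro hirr
  have : Finite (O ⧸ P) := by
    have := h.finite
    -- The residue field is a finitely generated abelian group killed by its positive
    -- characteristic.
    refine Module.finite_of_fg_torsion (O ⧸ P) fun {x} => ⟨⟨(ringChar (O ⧸ P) : ℤ), ?_⟩, ?_⟩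
    · exact mem_nonZeroDivisors_of_ne_zero (by omega)
    · change ((ringChar (O ⧸ P) : ℕ) : ℤ) • x = 0
      rw [zsmul_eq_mul]
      simp
  have hrank : Module.finrank (O ⧸ P) (torsion e P (AlgebraicClosure K)) = 2 := by
    have h1 := h.free_torsion P hP 1 le_rfl
    rw [pow_one] at h1
    obtain ⟨b⟩ := h1
    simpa using Module.finrank_eq_card_basis b
  have hrank' : Module.finrank (O ⧸ P) (torsion e P (torsionExt e P F)) = 2 :=
    (torsionEquiv e P F).finrank_eq.trans hrank
  refine subsingleton_H1_of_not_existsUnique_line hp _ hrank' (torsionRep_injective e P F) ?_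
  rintro ⟨l, ⟨hl1, hl⟩, -⟩
  let W : Subrepresentation (galRepRestrict e P F) :=
    { toSubmodule := l.map (torsionEquiv e P F).toLinearMap
      apply_mem_toSubmodule := by
        rintro τ _ ⟨y, hy, rfl⟩
        exact ⟨_, hl (restrictTorsionExt e P F τ) y hy, torsionEquiv_torsionRep e P F τ y⟩ }
  have hW : Module.finrank (O ⧸ P) W.toSubmodule = 1 :=
    ((torsionEquiv e P F).submoduleMap l).symm.finrank_eq.trans hl1
  rcases hirr.eq_bot_or_eq_top W with h0 | h0
  · have : W.toSubmodule = ⊥ := by rw [h0]; rfl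
    rw [this, finrank_bot] at hW
    omega
  · have : W.toSubmodule = ⊤ := by rw [h0]; rfl
    rw [this, finrank_top, hrank] at hW
    omega

end AbVar

/-- Taking `P` maximal loses nothing: a prime whose local ring is a discrete valuation ring is
nonzero, and nonzero primes of an order are maximal. -/
theorem mainTheorem9 :
    -- first part: subgroups of `GL₂` of a finite field
    (∀ (F : Type u) [Field F] [Finite F], 3 ≤ ringChar F →
      ∀ G : Subgroup (GL (Fin 2) F), (¬ ∃! l : Submodule F (Fin 2 → F), FixesLine G l) →
        Subsingleton (groupCohomology.H1 (Rep.of (standardRep G)))) ∧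
    -- second part: torsion of abelian varieties of `GL₂`-type
    (∀ (A : AbVar ℚ), A.IsAbsolutelySimple →
      ∀ (O : Type) [CommRing O] (e : O ≃+* A.EndK), AbVar.IsGL2Type e →
      ∀ (P : Ideal O) [P.IsMaximal], AbVar.IsRegularPrime P → 3 ≤ ringChar (O ⧸ P) →
      ∀ (F : IntermediateField ℚ (AlgebraicClosure ℚ)) [FiniteDimensional ℚ F] [IsGalois ℚ F],
        letI : Field (O ⧸ P) := Ideal.Quotient.field P
        (AbVar.galRepRestrict e P F).IsIrreducible →
        Subsingleton (groupCohomology.H1 (AbVar.torsionModule e P F))) := by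
  refine ⟨fun F _ _ hF G hG => subsingleton_H1_standardRep F hF G hG, ?_⟩
  intro A _ O _ e h P _ hP hp F _ _
  exact AbVar.subsingleton_H1_torsionModule e h P hP hp F
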